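/- Theorem B (Hardy–Morrey inequality). Let $n\ge 1$ be an integer, let $p>n$ be real, and put $X(t)=(1-\log t)^{-1}$ for $t\in(0,1]$. For a bounded domain (open connected set) $\Omega\subset\mathbb R^n$ containing the origin and a real-valued $u\in C_c^\infty(\Omega\setminus\{0\})$ put $$I[u]=\int_\Omega|\nabla u|^p\,dx-\Big(\frac{p-n}{p}\Big)^p\int_\Omega\frac{|u|^p}{|x|^p}\,dx .$$ (i) There exist constants $B\ge 1$ and $C>0$, depending only on $n$ and $p$, such that for every bounded domain $\Omega\subset\mathbb R^n$ containing the origin and every $u\in C_c^\infty(\Omega\setminus\{0\})$, $$\sup_{\substack{x,y\in\Omega\\ x\neq y}}\left\{\frac{|u(x)-u(y)|}{|x-y|^{1-n/p}}\,X^{1/p}\Big(\frac{|x-y|}{D}\Big)\right\}\le C\,I[u]^{1/p},\qquad D=B\operatorname{diam}(\Omega).$$ (ii) The power $1/p$ of $X$ cannot be decreased: for every real $q<1/p$, every bounded domain $\Omega\subset\mathbb R^n$ containing the origin, and all constants $B\ge1$ and $C>0$ (which may depend on $n$, $p$, $q$ and $\Omega$), the inequality $$\sup_{\substack{x,y\in\Omega\\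 x\neq y}}\left\{\frac{|u(x)-u(y)|}{|x-y|^{1-n/p}}\,X^{q}\Big(\frac{|x-y|}{D}\Big)\right\}\le C\,I[u]^{1/p},\qquad D=B\operatorname{diam}(\Omega),$$ fails for some $u\in C_c^\infty(\Omega\setminus\{0\})$. -/

import Mathlib

open MeasureTheory
open scoped ContDiff Gradient

/-- `u ∈ C_c^∞(U)`, with `u` extended by zero to the whole space: `u` is smooth, and its support
is a compact subset of `U`. -/
structure IsTestFunction {n : ℕ} (U : Set (EuclideanSpace ℝ (Fin n)))
    (u : EuclideanSpace ℝ (Fin n) → ℝ) : Prop where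
  contDiff : ContDiff ℝ ∞ u
  hasCompactSupport : HasCompactSupport u
  tsupport_subset : tsupport u ⊆ U

/-- A bounded domain (open connected set) of `ℝⁿ` containing the origin. -/
structure IsBoundedDomainWithOrigin {n : ℕ} (Ω : Set (EuclideanSpace ℝ (Fin n))) : Prop where
  isOpen : IsOpen Ω
  isConnected : IsConnected Ω
  isBounded : Bornology.IsBounded Ω
  zero_mem : (0 : EuclideanSpace ℝ (Fin n)) ∈ Ω

/-- The logarithmic correction `X(t) = (1 - log t)⁻¹`, used for `t ∈ (0, 1]`. -/
noncomputable def logX (t : ℝ) : ℝ := (1 - Real.log t)⁻¹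

/-- The sharp Hardy difference
`I[u] = ∫_Ω |∇u|^p dx - ((p - n)/p)^p ∫_Ω |u|^p / |x|^p dx`. -/
noncomputable def hardyDifference {n : ℕ} (p : ℝ) (Ω : Set (EuclideanSpace ℝ (Fin n)))
    (u : EuclideanSpace ℝ (Fin n) → ℝ) : ℝ :=
  (∫ x in Ω, ‖∇ u x‖ ^ p) - ((p - n) / p) ^ p * ∫ x in Ω, |u x| ^ p / ‖x‖ ^ p

/-- The weighted Hölder seminorm
`sup { |u(x) - u(y)| / |x - y|^(1 - n/p) * X(|x - y| / D)^q : x, y ∈ Ω, x ≠ y }`,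
a supremum in the extended reals. -/
noncomputable def weightedHolderSeminorm {n : ℕ} (p q D : ℝ)
    (Ω : Set (EuclideanSpace ℝ (Fin n))) (u : EuclideanSpace ℝ (Fin n) → ℝ) : EReal :=
  ⨆ (x ∈ Ω) (y ∈ Ω) (_ : x ≠ y),
    ((|u x - u y| / ‖x - y‖ ^ (1 - n / p) * logX (‖x - y‖ / D) ^ q : ℝ) : EReal)

/-!
Put `s = (p - n) / p` and compare `∇ u` with the vector field `a = s u x / |x| ^ 2` (`hardyField`).
The first-order Taylor polynomial of `|∇ u| ^ p` at `a` consists of `|a| ^ p`, which is the Hardy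
potential term, and of a divergence. Hence `I[u] = ∫ ρ`, where `ρ ≥ 0` is the convexity remainder
(`IsTestFunction.hardyDifference_eq`).

For the inequality, the pointwise estimate `exists_mul_norm_rpow_le_powRemainder` bounds
`|a| ^ (p - 1) |∇ u - a|` by `ε |a| ^ p + C ρ / ε`. Inserted into the divergence identity with a radial
weight concentrated logarithmically near `|x| = R`, it shows that on the annulus `|x| ∼ R` both
`∫ |u| ^ p / |x| ^ p` and `∫ |∇ u| ^ p` are at most `C (1 + log (D / R)) I[u]`
(`exists_setIntegral_weight_annulus_le`, `exists_setIntegral_gradient_annulus_le`). Morrey's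
inequality on balls inside such an annulus (`setIntegral_abs_sub_le`) turns this into a pointwise bound
of `u` and a Hölder bound for points with `|x - y| ≤ |x| / 2`; for all other pairs the pointwise bounds
of `u x` and `u y` are good enough. As `1 + log (D / d) = X(d / D)⁻¹`, this is the claim, with `B = 1`.

For optimality, cut the virtual ground state `|x| ^ s` off slowly on the logarithmic scale `[T, 2 T]`
of `-log |x|` (`logTest`). Its remainder is of order `T⁻² |x| ^ (-n)` on a shell of logarithmic width
`T`, so `I[u] = O(1 / T)`, whereas the quotient with `X ^ q` is of order `T ^ (-q)`.
-/

open scoped RealInnerProductSpace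

/-! ### Convexity remainder of the power of a norm -/

/-- The convexity remainder of `‖·‖ ^ p` at `a` in direction `b`: the excess of `‖a + b‖ ^ p` over
its first-order Taylor polynomial at `a`. For `p < 2` and `a = 0` the factor `‖a‖ ^ (p - 2)` has a
conventional value, which is harmless since the inner product vanishes there. -/
noncomputable def powRemainder {E : Type*} [NormedAddCommGroup E] [InnerProductSpace ℝ E]
    (p : ℝ) (a b : E) : ℝ :=
  ‖a + b‖ ^ p - ‖a‖ ^ p - p * ‖a‖ ^ (p - 2) * ⟪a, b⟫

/-- The quadratic lower bound of `(1 + b) ^ p` for `1 < p ≤ 2`: Bernoulli's inequality for the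
exponent `2 - p ∈ [0, 1)` gives `(1 + b) ^ p ≥ (1 + b) ^ 2 / (1 + (2 - p) * b)`, and this rational
function exceeds `1 + p * b` by `(p - 1) ^ 2 * b ^ 2 / (1 + (2 - p) * b)`. -/
lemma one_add_rpow_ge {p b : ℝ} (hp : 1 < p) (hp2 : p ≤ 2) (hb : |b| ≤ 1) :
    1 + p * b + (p - 1) ^ 2 / 2 * b ^ 2 ≤ (1 + b) ^ p := by
  obtain ⟨hb1, hb2⟩ := abs_le.1 hb
  rcases eq_or_lt_of_le hb1 with h | h
  · subst h
    have : (1 + -1 : ℝ) ^ p = 0 := by norm_num; exact Real.zero_rpow (by linarith)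
    rw [this]; nlinarith
  have hx : 0 < 1 + b := by linarith
  have hB : (1 + b) ^ (2 - p) ≤ 1 + (2 - p) * b :=
    rpow_one_add_le_one_add_mul_self hb1 (by linarith) (by linarith)
  have hmul : (1 + b) ^ p * (1 + b) ^ (2 - p) = (1 + b) ^ 2 := by
    rw [← Real.rpow_add hx, ← Real.rpow_natCast]; norm_num
  have hpos : 0 < (1 + b) ^ p := Real.rpow_pos_of_pos hx _
  have hd : 0 < 1 + (2 - p) * b := by nlinarith
  have h1 : (1 + b) ^ 2 ≤ (1 + b) ^ p * (1 + (2 - p) * b) := by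
    rw [← hmul]; gcongr
  have h2 : (1 + p * b + (p - 1) ^ 2 / 2 * b ^ 2) * (1 + (2 - p) * b) ≤ (1 + b) ^ 2 := by
    have : (1 + b) ^ 2 = (1 + p * b) * (1 + (2 - p) * b) + (p - 1) ^ 2 * b ^ 2 := by ring
    rw [this, add_mul]
    have h3 : 1 + (2 - p) * b ≤ 2 := by nlinarith
    have h4 : 0 ≤ (p - 1) ^ 2 * b ^ 2 := by positivity
    nlinarith
  exact le_of_mul_le_mul_right (h2.trans h1) hd

/-- A quadratic upper bound for the remainder of `|1 + b| ^ p`. The power `max p 2` absorbs large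
`b`; for small `b`, Bernoulli's inequality for `(1 + b)⁻¹` suffices. -/
lemma abs_one_add_rpow_le {p : ℝ} (hp : 1 < p) (b : ℝ) :
    |1 + b| ^ p ≤ 1 + p * b + (2 * p ^ 2 + (2 * p + 1) ^ max p 2) * (b ^ 2 + |b| ^ max p 2) := by
  set N := max p 2
  have hN2 : 2 ≤ N := le_max_right _ _
  have hNp : p ≤ N := le_max_left _ _
  have hK : 0 < (2 * p + 1) ^ N := Real.rpow_pos_of_pos (by linarith) _
  have hbN : 0 ≤ |b| ^ N := by positivity
  rcases le_or_gt (2 * p * |b|) 1 with h | h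
  · have habs := abs_le.1 (show |b| ≤ 1 / (2 * p) by rw [le_div_iff₀ (by linarith)]; linarith)
    have hinv : 1 / (2 * p) < 1 / 2 := by
      rw [div_lt_div_iff₀ (by linarith) (by norm_num)]; linarith
    have hx : 0 < 1 + b := by linarith
    have hpb : p * b ≤ 1 / 2 := by
      have := le_abs_self b; nlinarith
    have hpb' : - (1 / 2) ≤ p * b := by
      have := neg_abs_le b; nlinarith
    have hd : 1 / 2 ≤ 1 - (p - 1) * b := by
      rcases le_total b 0 with hb | hb <;> nlinarith
    have hB : 1 + p * (-b / (1 + b)) ≤ (1 + -b / (1 + b)) ^ p :=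
      one_add_mul_self_le_rpow_one_add (by rw [le_div_iff₀ hx]; linarith) hp.le
    have he : 1 + -b / (1 + b) = (1 + b)⁻¹ := by field_simp; ring
    rw [he, Real.inv_rpow hx.le] at hB
    have hpos : 0 < (1 + b) ^ p := Real.rpow_pos_of_pos hx _
    have h1 : (1 - (p - 1) * b) * (1 + b) ^ p ≤ 1 + b := by
      have : 1 + p * (-b / (1 + b)) = (1 - (p - 1) * b) / (1 + b) := by field_simp; ring
      rw [this, div_le_iff₀ hx] at hB
      calc (1 - (p - 1) * b) * (1 + b) ^ p ≤ ((1 + b) ^ p)⁻¹ * (1 + b) * (1 + b) ^ p := by gcongr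
        _ = 1 + b := by field_simp
    rw [abs_of_pos hx]
    have h2 : (1 + b) ^ p ≤ 1 + p * b + 2 * p ^ 2 * b ^ 2 := by
      refine le_of_mul_le_mul_left (h1.trans ?_) (show 0 < 1 - (p - 1) * b by linarith)
      have : (1 - (p - 1) * b) * (1 + p * b + 2 * p ^ 2 * b ^ 2)
        = (1 + b) + p * (1 - p) * b ^ 2 + (1 - (p - 1) * b) * (2 * p ^ 2 * b ^ 2) := by ring
      rw [this]
      have h4 : 1 / 2 * (2 * p ^ 2 * b ^ 2) ≤ (1 - (p - 1) * b) * (2 * p ^ 2 * b ^ 2) := by gcongr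
      nlinarith [sq_nonneg b]
    nlinarith [sq_nonneg b, mul_nonneg hK.le (sq_nonneg b), mul_nonneg hK.le hbN,
      mul_nonneg (sq_nonneg p) hbN]
  · have h1 : |1 + b| ≤ (2 * p + 1) * |b| := by
      calc |1 + b| ≤ |1| + |b| := abs_add_le _ _
        _ ≤ _ := by rw [abs_one]; linarith
    have hb0 : 0 ≤ |b| := abs_nonneg b
    have h2 : |1 + b| ^ p ≤ (2 * p + 1) ^ N * |b| ^ N := by
      rw [← Real.mul_rpow (by linarith) (by positivity)]
      calc |1 + b| ^ p ≤ ((2 * p + 1) * |b|) ^ p := by gcongr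
        _ ≤ _ := Real.rpow_le_rpow_of_exponent_le (by nlinarith) hNp
    have h3 : - (p * b) ≤ 2 * p ^ 2 * b ^ 2 := by
      have : -b ≤ |b| := neg_le_abs b
      rw [← sq_abs b]
      nlinarith [mul_nonneg (by linarith : 0 ≤ p) hb0]
    nlinarith [sq_nonneg b, mul_nonneg hK.le (sq_nonneg b), mul_nonneg hK.le hbN,
      mul_nonneg (sq_nonneg p) hbN]

section
variable {E : Type*} [NormedAddCommGroup E] [InnerProductSpace ℝ E]

lemma powRemainder_smul {p : ℝ} {k : ℝ} (hk : 0 < k) (a b : E) :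
    powRemainder p (k • a) (k • b) = k ^ p * powRemainder p a b := by
  unfold powRemainder
  rw [← smul_add, norm_smul, norm_smul, Real.norm_of_nonneg hk.le,
    Real.mul_rpow hk.le (norm_nonneg _), Real.mul_rpow hk.le (norm_nonneg _),
    Real.mul_rpow hk.le (norm_nonneg _), real_inner_smul_left, real_inner_smul_right,
    show k ^ p = k ^ (p - 2) * k * k by
      rw [← Real.rpow_add_one hk.ne', ← Real.rpow_add_one hk.ne']; ring_nf]
  ring

lemma powRemainder_of_norm_eq_one {p : ℝ} {a : E} (ha : ‖a‖ = 1) (b : E) :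
    powRemainder p a b = (1 + 2 * ⟪a, b⟫ + ‖b‖ ^ 2) ^ (p / 2) - 1 - p * ⟪a, b⟫ := by
  unfold powRemainder
  have : ‖a + b‖ ^ p = (‖a + b‖ ^ 2) ^ (p / 2) := by
    rw [← Real.rpow_natCast, ← Real.rpow_mul (norm_nonneg _)]; congr 1; push_cast; ring
  rw [this, norm_add_sq_real, ha]; simp

/-- For unit `a` and fixed `‖b‖`, the remainder is a concave function of `⟪a, b⟫` when `p ≤ 2`, so
that it is smallest when `b` is parallel to `a`, which is the scalar case. -/
lemma powRemainder_ge_sq {p : ℝ} (hp : 1 < p) (hp2 : p ≤ 2) {a b : E} (ha : ‖a‖ = 1)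
    (hb : ‖b‖ ≤ 1) : (p - 1) ^ 2 / 2 * ‖b‖ ^ 2 ≤ powRemainder p a b := by
  rw [powRemainder_of_norm_eq_one ha]
  rcases eq_or_lt_of_le (norm_nonneg b) with h0 | h0
  · have : b = 0 := norm_eq_zero.1 h0.symm
    subst this; simp
  set β := ‖b‖
  set c := ⟪a, b⟫
  have hc : |c| ≤ β := by simpa [ha] using abs_real_inner_le_norm a b
  obtain ⟨hc1, hc2⟩ := abs_le.1 hc
  have key : ∀ t, |t| ≤ 1 → 1 + p * t + (p - 1) ^ 2 / 2 * t ^ 2 ≤ ((1 + t) ^ 2) ^ (p / 2) := by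
    intro t ht
    refine (one_add_rpow_ge hp hp2 ht).trans_eq ?_
    rw [← Real.rpow_natCast, ← Real.rpow_mul (by linarith [(abs_le.1 ht).1])]
    congr 1; push_cast; ring
  have k1 := key β (by rw [abs_of_pos h0]; exact hb)
  have k2 := key (-β) (by rw [abs_neg, abs_of_pos h0]; exact hb)
  set l := (1 + c / β) / 2
  have hcb : c / β * β = c := by field_simp
  have hcβ1 : c / β ≤ 1 := by rw [div_le_one h0]; exact hc2
  have hcβ2 : -1 ≤ c / β := by rw [le_div_iff₀ h0]; linarith
  have hl0 : 0 ≤ l := by simp only [l]; linarith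
  have hl1 : 0 ≤ 1 - l := by simp only [l]; linarith
  have hl : (2 * l - 1) * β = c := by simp only [l]; rw [← hcb]; field_simp; ring
  have hconc := (Real.concaveOn_rpow (p := p / 2) (by linarith) (by linarith)).2
    (Set.mem_Ici.2 (sq_nonneg (1 + β))) (Set.mem_Ici.2 (sq_nonneg (1 + -β))) hl0 hl1 (by ring)
  simp only [smul_eq_mul] at hconc
  have he : l * (1 + β) ^ 2 + (1 - l) * (1 + -β) ^ 2 = 1 + 2 * c + β ^ 2 := by rw [← hl]; ring
  rw [he] at hconc
  have k3 := mul_le_mul_of_nonneg_left k1 hl0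
  have k4 := mul_le_mul_of_nonneg_left k2 hl1
  have : l * (1 + p * β + (p - 1) ^ 2 / 2 * β ^ 2) +
      (1 - l) * (1 + p * -β + (p - 1) ^ 2 / 2 * (-β) ^ 2)
      = 1 + p * ((2 * l - 1) * β) + (p - 1) ^ 2 / 2 * β ^ 2 := by ring
  rw [hl] at this
  linarith

/-- For unit `a` the remainder is at least of the order of `‖b‖ ^ 2` for small `b` and of `‖b‖` for
large `b`. -/
lemma exists_powRemainder_ge_min {p : ℝ} (hp : 1 < p) :
    ∃ k : ℝ, 0 < k ∧ ∀ a b : E, ‖a‖ = 1 → k * min ‖b‖ (‖b‖ ^ 2) ≤ powRemainder p a b := by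
  rcases le_total p 2 with hp2 | hp2
  · refine ⟨(p - 1) ^ 2 / 2, by have : 0 < p - 1 := by linarith
                                positivity, fun a b ha => ?_⟩
    rcases le_or_gt ‖b‖ 1 with h | h
    · exact (mul_le_mul_of_nonneg_left (min_le_right _ _) (by positivity)).trans
        (powRemainder_ge_sq hp hp2 ha h)
    -- `β ↦ powRemainder p a (β • e)` is convex and vanishes at `0`, so its growth beyond `‖b‖ = 1`
    -- is at least linear
    · refine (mul_le_mul_of_nonneg_left (min_le_left _ _) (by positivity)).trans ?_
      set β := ‖b‖
      have hβ : 0 < β := by linarith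
      have h1 := powRemainder_ge_sq hp hp2 ha (b := β⁻¹ • b)
        (by rw [norm_smul, norm_inv, norm_norm, inv_mul_cancel₀ hβ.ne'])
      rw [norm_smul, norm_inv, norm_norm, inv_mul_cancel₀ hβ.ne'] at h1
      unfold powRemainder at h1 ⊢
      rw [real_inner_smul_right, ha] at h1
      rw [ha]
      simp only [Real.one_rpow, mul_one, one_pow] at h1 ⊢
      have hw : 0 ≤ 1 - β⁻¹ := by
        have : β⁻¹ ≤ 1 := inv_le_one_of_one_le₀ h.le
        linarith
      have hconv := (convexOn_rpow hp.le).2 (Set.mem_Ici.2 zero_le_one)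
        (Set.mem_Ici.2 (norm_nonneg (a + b))) hw (inv_nonneg.2 hβ.le) (by ring)
      simp only [smul_eq_mul, mul_one, Real.one_rpow] at hconv
      have hn : ‖a + β⁻¹ • b‖ ≤ (1 - β⁻¹) + β⁻¹ * ‖a + b‖ := by
        have : a + β⁻¹ • b = (1 - β⁻¹) • a + β⁻¹ • (a + b) := by module
        rw [this]
        refine (norm_add_le _ _).trans ?_
        rw [norm_smul, norm_smul, ha, Real.norm_of_nonneg hw,
          Real.norm_of_nonneg (inv_nonneg.2 hβ.le), mul_one]
      have h2 : ‖a + β⁻¹ • b‖ ^ p ≤ (1 - β⁻¹) + β⁻¹ * ‖a + b‖ ^ p :=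
        (Real.rpow_le_rpow (norm_nonneg _) hn (by linarith)).trans hconv
      have h3 : (p - 1) ^ 2 / 2 ≤ β⁻¹ * (‖a + b‖ ^ p - 1 - p * ⟪a, b⟫) := by
        have : β⁻¹ * (‖a + b‖ ^ p - 1 - p * ⟪a, b⟫) =
          (1 - β⁻¹) + β⁻¹ * ‖a + b‖ ^ p - 1 - p * (β⁻¹ * ⟪a, b⟫) := by ring
        rw [this]; linarith
      rw [inv_mul_eq_div, le_div_iff₀ hβ] at h3
      exact h3
  · refine ⟨p / 2, by linarith, fun a b ha => ?_⟩
    refine (mul_le_mul_of_nonneg_left (min_le_right _ _) (by linarith)).trans ?_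
    rw [powRemainder_of_norm_eq_one ha]
    have h0 : 0 ≤ ‖a + b‖ ^ 2 := sq_nonneg _
    rw [norm_add_sq_real, ha] at h0
    have := one_add_mul_self_le_rpow_one_add (s := 2 * ⟪a, b⟫ + ‖b‖ ^ 2) (by linarith)
      (p := p / 2) (by linarith)
    rw [← add_assoc] at this
    linarith

/-- The pointwise inequality behind the improved Hardy inequality: the remainder controls the mixed
term `‖a‖ ^ (p - 1) * ‖b‖` up to a multiple of `‖a‖ ^ p` as small as desired. It holds for every
`p > 1`, so that `p < 2` (possible only in dimension one) needs no separate argument below. -/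
theorem exists_mul_norm_rpow_le_powRemainder {p : ℝ} (hp : 1 < p) :
    ∃ C : ℝ, 0 < C ∧ ∀ (a b : E) (ε : ℝ), 0 < ε → ε ≤ 1 →
      ε * (‖a‖ ^ (p - 1) * ‖b‖) ≤ ε ^ 2 * ‖a‖ ^ p + C * powRemainder p a b := by
  obtain ⟨k, hk, hmin⟩ := exists_powRemainder_ge_min (E := E) hp
  refine ⟨k⁻¹, inv_pos.2 hk, fun a b ε hε hε1 => ?_⟩
  rcases eq_or_ne a 0 with rfl | ha
  · have : powRemainder p 0 b = ‖b‖ ^ p := by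
      simp [powRemainder, Real.zero_rpow (by linarith : p ≠ 0)]
    rw [this, norm_zero, Real.zero_rpow (by linarith), Real.zero_rpow (by linarith)]
    have : 0 ≤ k⁻¹ * ‖b‖ ^ p := by positivity
    simpa using this
  have hA : 0 < ‖a‖ := norm_pos_iff.2 ha
  set A := ‖a‖
  have unit := hmin (A⁻¹ • a) (A⁻¹ • b) (by rw [norm_smul, norm_inv, norm_norm,
    inv_mul_cancel₀ hA.ne'])
  rw [powRemainder_smul (inv_pos.2 hA), norm_smul, norm_inv, norm_norm,
    Real.inv_rpow hA.le] at unit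
  set β := A⁻¹ * ‖b‖
  have hβ : 0 ≤ β := by positivity
  have hAp : 0 < A ^ p := Real.rpow_pos_of_pos hA _
  have e1 : A ^ (p - 1) * ‖b‖ = A ^ p * β := by
    rw [Real.rpow_sub_one hA.ne']; simp only [β]; field_simp
  have h1 : ε * β ≤ ε ^ 2 + min β (β ^ 2) := by
    rcases le_total β (β ^ 2) with h | h
    · rw [min_eq_left h]; nlinarith [sq_nonneg ε]
    · rw [min_eq_right h]; nlinarith [sq_nonneg (ε - β), mul_nonneg hε.le hβ]
  have h2 : min β (β ^ 2) ≤ k⁻¹ * ((A ^ p)⁻¹ * powRemainder p a b) := by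
    rw [inv_mul_eq_div k, le_div_iff₀ hk]; linarith
  rw [e1]
  calc ε * (A ^ p * β) = A ^ p * (ε * β) := by ring
    _ ≤ A ^ p * (ε ^ 2 + k⁻¹ * ((A ^ p)⁻¹ * powRemainder p a b)) := by gcongr; linarith
    _ = _ := by field_simp

lemma powRemainder_nonneg {p : ℝ} (hp : 1 < p) (a b : E) : 0 ≤ powRemainder p a b := by
  obtain ⟨C, hC, h⟩ := exists_mul_norm_rpow_le_powRemainder (E := E) hp
  -- let `ε → 0` in the inequality above
  refine nonneg_of_mul_nonneg_right (le_of_forall_pos_le_add fun δ hδ => ?_) hC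
  set Y := ‖a‖ ^ p
  have hY : 0 ≤ Y := by positivity
  have hm : 0 < min 1 (δ / (Y + 1)) := lt_min one_pos (by positivity)
  have h1 := h a b _ hm (min_le_left _ _)
  set ε := min 1 (δ / (Y + 1))
  have h2 : ε * (Y + 1) ≤ δ := (le_div_iff₀ (by positivity)).1 (min_le_right _ _)
  have h3 : ε ≤ 1 := min_le_left _ _
  have h4 : 0 ≤ ε * (‖a‖ ^ (p - 1) * ‖b‖) := by positivity
  nlinarith [mul_nonneg (mul_nonneg hm.le hY) (sub_nonneg.2 h3)]

end

/-! ### The Hardy difference as the integral of a remainder -/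

section
variable {n : ℕ}

/-- The vector field `F(x) x` has integral divergence zero. -/
theorem integral_mul_add_fderiv_self_eq_zero {F : EuclideanSpace ℝ (Fin n) → ℝ}
    (hF : ContDiff ℝ 1 F) (hc : HasCompactSupport F) :
    ∫ x, (n * F x + fderiv ℝ F x x) = 0 := by
  have hdiff : Differentiable ℝ F := hF.differentiable one_ne_zero
  have hF' : Continuous (fderiv ℝ F) := hF.continuous_fderiv one_ne_zero
  have hcF' : HasCompactSupport (fderiv ℝ F) := hc.fderiv (𝕜 := ℝ)
  have hi1 : Integrable F := hF.continuous.integrable_of_hasCompactSupport hc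
  have hi2 : ∀ i : Fin n, Integrable fun x : EuclideanSpace ℝ (Fin n) =>
      x i * fderiv ℝ F x (EuclideanSpace.single i 1) := fun i => by
    refine Continuous.integrable_of_hasCompactSupport
      (by fun_prop) (HasCompactSupport.intro hcF' fun x hx => ?_)
    rw [image_eq_zero_of_notMem_tsupport hx]; simp
  have key : ∀ i : Fin n, ∫ x : EuclideanSpace ℝ (Fin n),
      (F x + x i * fderiv ℝ F x (EuclideanSpace.single i 1)) = 0 := fun i => by
    have hproj : ∀ x : EuclideanSpace ℝ (Fin n),
        fderiv ℝ (fun y : EuclideanSpace ℝ (Fin n) => y i) x (EuclideanSpace.single i 1) = 1 := by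
      intro x
      have : HasFDerivAt (fun y : EuclideanSpace ℝ (Fin n) => y i)
        (EuclideanSpace.proj i : EuclideanSpace ℝ (Fin n) →L[ℝ] ℝ) x :=
        (EuclideanSpace.proj i : EuclideanSpace ℝ (Fin n) →L[ℝ] ℝ).hasFDerivAt
      rw [this.fderiv]; simp
    have := integral_mul_fderiv_eq_neg_fderiv_mul_of_integrable
      (μ := (volume : Measure (EuclideanSpace ℝ (Fin n))))
      (f := fun y : EuclideanSpace ℝ (Fin n) => y i) (g := F) (v := EuclideanSpace.single i 1)
      (by simpa only [hproj, one_mul] using hi1) (hi2 i)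
      (Continuous.integrable_of_hasCompactSupport (by fun_prop) hc.mul_left)
      (fun x _ => by fun_prop) (fun x _ => hdiff x)
    simp only [hproj, one_mul] at this
    rw [integral_add hi1 (hi2 i), this, add_neg_cancel]
  have hsum : ∀ x, n * F x + fderiv ℝ F x x
      = ∑ i : Fin n, (F x + x i * fderiv ℝ F x (EuclideanSpace.single i 1)) := by
    intro x
    rw [Finset.sum_add_distrib, Finset.sum_const, Finset.card_univ, Fintype.card_fin,
      nsmul_eq_mul]
    congr 1
    have hx : x = ∑ i : Fin n, x i • (EuclideanSpace.single i (1 : ℝ)) := by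
      ext j; simp [Finset.sum_apply, Pi.single_apply]
    conv_lhs => rw [hx, map_sum]
    simp only [map_smul, smul_eq_mul, ← hx]
  simp_rw [hsum]
  rw [integral_finsetSum Finset.univ (f := fun i x =>
    F x + x i * fderiv ℝ F x (EuclideanSpace.single i 1)) fun i _ => hi1.add (hi2 i)]
  exact Finset.sum_eq_zero fun i _ => key i

namespace IsTestFunction

variable {u : EuclideanSpace ℝ (Fin n) → ℝ} {p : ℝ}

lemma mono {U V : Set (EuclideanSpace ℝ (Fin n))} (hu : IsTestFunction U u) (h : U ⊆ V) :
    IsTestFunction V u :=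
  ⟨hu.contDiff, hu.hasCompactSupport, hu.tsupport_subset.trans h⟩

lemma ne_zero_of_mem_tsupport (hu : IsTestFunction {0}ᶜ u) {x : EuclideanSpace ℝ (Fin n)}
    (hx : x ∈ tsupport u) : x ≠ 0 :=
  hu.tsupport_subset hx

lemma gradient_eq_zero {x : EuclideanSpace ℝ (Fin n)} (hx : x ∉ tsupport u) : ∇ u x = 0 := by
  have : fderiv ℝ u x = 0 :=
    image_eq_zero_of_notMem_tsupport fun h => hx (tsupport_fderiv_subset ℝ h)
  simp [gradient, this]

lemma continuous_gradient {U : Set (EuclideanSpace ℝ (Fin n))} (hu : IsTestFunction U u) :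
    Continuous (∇ u) := by
  have := hu.contDiff.continuous_fderiv (by simp)
  unfold gradient
  exact (LinearIsometryEquiv.continuous _).comp this

lemma contDiffAt_of_notMem {f : EuclideanSpace ℝ (Fin n) → ℝ}
    (hf : ∀ x, x ∉ tsupport u → f x = 0) {x : EuclideanSpace ℝ (Fin n)} (hx : x ∉ tsupport u) :
    ContDiffAt ℝ 1 f x :=
  (contDiffAt_const (c := (0 : ℝ))).congr_of_eventuallyEq <| by
    filter_upwards [(isClosed_tsupport u).isOpen_compl.mem_nhds hx] with y hy using hf y hy

lemma fderiv_eq_zero_of_notMem {f : EuclideanSpace ℝ (Fin n) → ℝ}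
    (hf : ∀ x, x ∉ tsupport u → f x = 0) {x : EuclideanSpace ℝ (Fin n)} (hx : x ∉ tsupport u) :
    fderiv ℝ f x = 0 := by
  have : f =ᶠ[nhds x] fun _ => 0 := by
    filter_upwards [(isClosed_tsupport u).isOpen_compl.mem_nhds hx] with y hy using hf y hy
  rw [this.fderiv_eq]; simp

/-- A function vanishing off `tsupport u` only has to be continuous away from the origin in order to
be integrable. -/
lemma integrable (hu : IsTestFunction {0}ᶜ u) {f : EuclideanSpace ℝ (Fin n) → ℝ}
    (hf : ∀ x, x ∉ tsupport u → f x = 0) (hc : ∀ x, x ≠ 0 → ContinuousAt f x) :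
    Integrable f := by
  refine Continuous.integrable_of_hasCompactSupport (continuous_iff_continuousAt.2 fun x => ?_)
    (HasCompactSupport.intro hu.hasCompactSupport fun x hx => hf x hx)
  by_cases hx : x ∈ tsupport u
  · exact hc x (hu.ne_zero_of_mem_tsupport hx)
  · exact (contDiffAt_of_notMem hf hx).continuousAt

lemma contDiff_abs_rpow {U : Set (EuclideanSpace ℝ (Fin n))} (hu : IsTestFunction U u)
    (hp : 1 < p) : ContDiff ℝ 1 fun x => |u x| ^ p := by
  simpa only [Real.norm_eq_abs] using
    (hu.contDiff.of_le (by norm_cast)).norm_rpow hp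

lemma fderiv_abs_rpow {U : Set (EuclideanSpace ℝ (Fin n))} (hu : IsTestFunction U u)
    (hp : 1 < p) (x y : EuclideanSpace ℝ (Fin n)) :
    fderiv ℝ (fun x => |u x| ^ p) x y = p * |u x| ^ (p - 2) * u x * ⟪∇ u x, y⟫ := by
  have h := (hasDerivAt_abs_rpow (u x) hp).comp_hasFDerivAt x
    (hu.contDiff.differentiable (by simp) x).hasFDerivAt
  have h' : fderiv ℝ (fun x => |u x| ^ p) x = (p * |u x| ^ (p - 2) * u x) • fderiv ℝ u x :=
    h.fderiv
  rw [h', inner_gradient_left]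
  simp

lemma abs_rpow_eq_zero (hp : 1 < p) {x : EuclideanSpace ℝ (Fin n)} (hx : x ∉ tsupport u) :
    |u x| ^ p = 0 := by
  rw [image_eq_zero_of_notMem_tsupport hx, abs_zero, Real.zero_rpow (by linarith)]

/-- The divergence of `|u| ^ p * ‖x‖ ^ (-p) * θ(‖x‖) * x` has integral zero. -/
theorem integral_radial_identity (hu : IsTestFunction {0}ᶜ u) (hp : 1 < p) {θ : ℝ → ℝ}
    (hθ : ContDiffOn ℝ 1 θ (Set.Ioi 0)) :
    ∫ x, ‖x‖ ^ (-p) * (θ ‖x‖ * (fderiv ℝ (fun x => |u x| ^ p) x x - (p - n) * |u x| ^ p)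
      + ‖x‖ * deriv θ ‖x‖ * |u x| ^ p) = 0 := by
  set G := fun x => |u x| ^ p with hG
  have hGc : ContDiff ℝ 1 G := hu.contDiff_abs_rpow hp
  set φ : EuclideanSpace ℝ (Fin n) → ℝ := fun x => ‖x‖ ^ (-p) * θ ‖x‖ with hφ
  have hnorm : ∀ x : EuclideanSpace ℝ (Fin n), x ≠ 0 → ContDiffAt ℝ 1 (fun y => ‖y‖) x :=
    fun x hx => contDiffAt_norm ℝ hx
  have hθx : ∀ x : EuclideanSpace ℝ (Fin n), x ≠ 0 → ContDiffAt ℝ 1 θ ‖x‖ := fun x hx =>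
    hθ.contDiffAt (Ioi_mem_nhds (norm_pos_iff.2 hx))
  have hφc : ∀ x, x ≠ 0 → ContDiffAt ℝ 1 φ x := fun x hx =>
    ((hnorm x hx).rpow_const_of_ne (norm_pos_iff.2 hx).ne').mul ((hθx x hx).comp x (hnorm x hx))
  have hφd : ∀ x, x ≠ 0 → fderiv ℝ φ x x
      = ‖x‖ ^ (-p) * (-p * θ ‖x‖ + ‖x‖ * deriv θ ‖x‖) := by
    intro x hx
    have hx0 := norm_pos_iff.2 hx
    have hn := (hnorm x hx).differentiableAt one_ne_zero
    have h1 : HasDerivAt (fun r : ℝ => r ^ (-p) * θ r)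
        (-p * ‖x‖ ^ (-p - 1) * θ ‖x‖ + ‖x‖ ^ (-p) * deriv θ ‖x‖) ‖x‖ :=
      (Real.hasDerivAt_rpow_const (Or.inl hx0.ne')).mul
        ((hθx x hx).differentiableAt one_ne_zero).hasDerivAt
    have h2 : fderiv ℝ φ x = (-p * ‖x‖ ^ (-p - 1) * θ ‖x‖ + ‖x‖ ^ (-p) * deriv θ ‖x‖) •
        fderiv ℝ (fun y : EuclideanSpace ℝ (Fin n) => ‖y‖) x :=
      (h1.comp_hasFDerivAt x hn.hasFDerivAt).fderiv
    rw [h2, smul_apply, hn.fderiv_norm_self, smul_eq_mul,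
      Real.rpow_sub_one hx0.ne']
    field_simp
  have hF0 : ∀ x, x ∉ tsupport u → G x * φ x = 0 := fun x hx => by
    rw [show G x = 0 from abs_rpow_eq_zero hp hx, zero_mul]
  have hF : ContDiff ℝ 1 fun x => G x * φ x := by
    refine contDiff_iff_contDiffAt.2 fun x => ?_
    by_cases hx : x ∈ tsupport u
    · exact hGc.contDiffAt.mul (hφc x (hu.ne_zero_of_mem_tsupport hx))
    · exact contDiffAt_of_notMem hF0 hx
  rw [← integral_mul_add_fderiv_self_eq_zero hF
    (HasCompactSupport.intro hu.hasCompactSupport hF0)]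
  congr 1
  ext x
  by_cases hx : x ∈ tsupport u
  · have hx0 := hu.ne_zero_of_mem_tsupport hx
    rw [fderiv_fun_mul (hGc.differentiable one_ne_zero x)
      ((hφc x hx0).differentiableAt one_ne_zero)]
    simp only [add_apply, smul_apply, smul_eq_mul,
      hφd x hx0]
    simp only [hφ]
    ring
  · rw [fderiv_eq_zero_of_notMem hF0 hx,
      fderiv_eq_zero_of_notMem (fun x hx => abs_rpow_eq_zero hp hx) hx]
    simp [hG, abs_rpow_eq_zero hp hx]

end IsTestFunction

/-- The radial vector `((p - n) / p) * (u x) * x / |x| ^ 2`. It would be the gradient of `u` if `u`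
were a multiple of the virtual ground state `|x| ^ ((p - n) / p)` of the Hardy inequality, and its
norm to the power `p` is the Hardy potential term. -/
noncomputable def hardyField (p : ℝ) (u : EuclideanSpace ℝ (Fin n) → ℝ)
    (x : EuclideanSpace ℝ (Fin n)) : EuclideanSpace ℝ (Fin n) :=
  ((p - n) / p * u x / ‖x‖ ^ 2) • x

/-- The convexity remainder of `|∇ u| ^ p` at `hardyField p u`, a nonnegative density whose integral
is the Hardy difference. -/
noncomputable def hardyRemainder (p : ℝ) (u : EuclideanSpace ℝ (Fin n) → ℝ)
    (x : EuclideanSpace ℝ (Fin n)) : ℝ :=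
  powRemainder p (hardyField p u x) (∇ u x - hardyField p u x)

section
variable {u : EuclideanSpace ℝ (Fin n) → ℝ} {p : ℝ}

lemma norm_hardyField (hp : n < p) {x : EuclideanSpace ℝ (Fin n)} (hx : x ≠ 0) :
    ‖hardyField p u x‖ = (p - n) / p * |u x| * ‖x‖⁻¹ := by
  have hp0 : 0 < p := (Nat.cast_nonneg n).trans_lt hp
  have hs : 0 ≤ (p - n) / p := div_nonneg (by linarith) hp0.le
  have hx0 := norm_pos_iff.2 hx
  rw [hardyField, norm_smul, Real.norm_eq_abs, abs_div, abs_mul, abs_of_nonneg hs,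
    abs_of_nonneg (sq_nonneg ‖x‖)]
  field_simp

lemma norm_hardyField_rpow (hp : n < p) {x : EuclideanSpace ℝ (Fin n)} (hx : x ≠ 0) (α : ℝ) :
    ‖hardyField p u x‖ ^ α = ((p - n) / p) ^ α * |u x| ^ α * ‖x‖ ^ (-α) := by
  have hp0 : 0 < p := (Nat.cast_nonneg n).trans_lt hp
  have hs : 0 ≤ (p - n) / p := div_nonneg (by linarith) hp0.le
  rw [norm_hardyField hp hx, Real.mul_rpow (by positivity) (by positivity),
    Real.mul_rpow hs (by positivity), Real.inv_rpow (norm_nonneg _), Real.rpow_neg (norm_nonneg _)]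

/-- The linear term of the Taylor expansion of `|∇ u| ^ p` at `hardyField p u` is, up to a constant,
a divergence: compare `IsTestFunction.integral_radial_identity` with `θ = 1`. -/
lemma hardyField_cross_term {U : Set (EuclideanSpace ℝ (Fin n))} (hu : IsTestFunction U u)
    (hp1 : 1 < p) (hp : n < p) {x : EuclideanSpace ℝ (Fin n)} (hx : x ≠ 0) :
    p * ‖hardyField p u x‖ ^ (p - 2) * ⟪hardyField p u x, ∇ u x - hardyField p u x⟫
      = ((p - n) / p) ^ (p - 1) * (‖x‖ ^ (-p) *
        (fderiv ℝ (fun x => |u x| ^ p) x x - (p - n) * |u x| ^ p)) := by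
  have hp0 : 0 < p := by linarith
  have hx0 := norm_pos_iff.2 hx
  have hs : 0 < (p - n) / p := div_pos (by linarith) hp0
  rw [norm_hardyField_rpow hp hx, hu.fderiv_abs_rpow hp1]
  have e1 : ⟪hardyField p u x, ∇ u x - hardyField p u x⟫
      = (p - n) / p * u x / ‖x‖ ^ 2 * (⟪∇ u x, x⟫ - (p - n) / p * u x) := by
    rw [hardyField, real_inner_smul_left, inner_sub_right, real_inner_smul_right,
      real_inner_self_eq_norm_sq, real_inner_comm]
    field_simp
  have e2 : ‖x‖ ^ (-(p - 2)) = ‖x‖ ^ (-p) * ‖x‖ ^ 2 := by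
    rw [← Real.rpow_natCast ‖x‖ 2, ← Real.rpow_add hx0]; congr 1; push_cast; ring
  have e3 : ((p - n) / p) ^ (p - 1) = ((p - n) / p) ^ (p - 2) * ((p - n) / p) := by
    rw [← Real.rpow_add_one hs.ne']; congr 1; ring
  have e4 : |u x| ^ p = |u x| ^ (p - 2) * (u x) ^ 2 := by
    rcases eq_or_ne (u x) 0 with h | h
    · simp [h, Real.zero_rpow hp0.ne']
    · rw [← sq_abs, ← Real.rpow_natCast, ← Real.rpow_add (abs_pos.2 h)]; congr 1; push_cast; ring
  rw [e1, e2, e3, e4]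
  field_simp

lemma hardyField_eq_zero {x : EuclideanSpace ℝ (Fin n)} (hx : x ∉ tsupport u) :
    hardyField p u x = 0 := by
  simp [hardyField, image_eq_zero_of_notMem_tsupport hx]

lemma hardyRemainder_nonneg (hp : 1 < p) (x : EuclideanSpace ℝ (Fin n)) :
    0 ≤ hardyRemainder p u x := powRemainder_nonneg hp _ _

lemma hardyRemainder_eq_zero (hp : 1 < p) {x : EuclideanSpace ℝ (Fin n)} (hx : x ∉ tsupport u) :
    hardyRemainder p u x = 0 := by
  simp [hardyRemainder, hardyField_eq_zero hx, IsTestFunction.gradient_eq_zero hx, powRemainder,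
    Real.zero_rpow (by linarith : p ≠ 0)]

lemma hardyRemainder_eq {U : Set (EuclideanSpace ℝ (Fin n))} (hu : IsTestFunction U u)
    (hp1 : 1 < p) (hp : n < p) {x : EuclideanSpace ℝ (Fin n)} (hx : x ≠ 0) :
    hardyRemainder p u x = ‖∇ u x‖ ^ p - ((p - n) / p) ^ p * (‖x‖ ^ (-p) * |u x| ^ p)
      - ((p - n) / p) ^ (p - 1) * (‖x‖ ^ (-p) *
        (fderiv ℝ (fun x => |u x| ^ p) x x - (p - n) * |u x| ^ p)) := by
  rw [← hardyField_cross_term hu hp1 hp hx, hardyRemainder, powRemainder,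
    norm_hardyField_rpow hp hx p]
  rw [add_sub_cancel]; ring

namespace IsTestFunction

lemma integrable_weight (hu : IsTestFunction {0}ᶜ u) (hp1 : 1 < p) :
    Integrable fun x => ‖x‖ ^ (-p) * |u x| ^ p := by
  refine hu.integrable (fun x hx => by rw [abs_rpow_eq_zero hp1 hx, mul_zero]) fun x hx => ?_
  exact (continuous_norm.continuousAt.rpow_const (Or.inl (norm_pos_iff.2 hx).ne')).mul
    (hu.contDiff_abs_rpow hp1).continuous.continuousAt

lemma integrable_gradient (hu : IsTestFunction {0}ᶜ u) (hp1 : 1 < p) :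
    Integrable fun x => ‖∇ u x‖ ^ p := by
  refine hu.integrable (fun x hx => by
    rw [gradient_eq_zero hx, norm_zero, Real.zero_rpow (by linarith)]) fun x hx => ?_
  exact (hu.continuous_gradient.norm.rpow_const fun _ => Or.inr (by linarith)).continuousAt

lemma fderiv_abs_rpow_eq_zero (hu : IsTestFunction {0}ᶜ u) (hp1 : 1 < p)
    {x : EuclideanSpace ℝ (Fin n)} (hx : x ∉ tsupport u) (y : EuclideanSpace ℝ (Fin n)) :
    fderiv ℝ (fun x => |u x| ^ p) x y = 0 := by
  rw [hu.fderiv_abs_rpow hp1, image_eq_zero_of_notMem_tsupport hx]; simp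

lemma integrable_cross (hu : IsTestFunction {0}ᶜ u) (hp1 : 1 < p) :
    Integrable fun x => ‖x‖ ^ (-p) *
        (fderiv ℝ (fun x => |u x| ^ p) x x - (p - n) * |u x| ^ p) := by
  refine hu.integrable (fun x hx => by
    rw [abs_rpow_eq_zero hp1 hx, hu.fderiv_abs_rpow_eq_zero hp1 hx]; simp) fun x hx => ?_
  have h1 := hu.contDiff_abs_rpow hp1
  have h2 : Continuous fun x => fderiv ℝ (fun x => |u x| ^ p) x x :=
    (h1.continuous_fderiv one_ne_zero).clm_apply continuous_id
  exact (continuous_norm.continuousAt.rpow_const (Or.inl (norm_pos_iff.2 hx).ne')).mul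
    (h2.sub (continuous_const.mul h1.continuous)).continuousAt

lemma hardyRemainder_eq_fun (hu : IsTestFunction {0}ᶜ u) (hp1 : 1 < p) (hp : n < p) :
    hardyRemainder p u = fun x => ‖∇ u x‖ ^ p - ((p - n) / p) ^ p * (‖x‖ ^ (-p) * |u x| ^ p)
      - ((p - n) / p) ^ (p - 1) * (‖x‖ ^ (-p) *
        (fderiv ℝ (fun x => |u x| ^ p) x x - (p - n) * |u x| ^ p)) := by
  ext x
  by_cases hx : x ∈ tsupport u
  · exact hardyRemainder_eq hu hp1 hp (hu.ne_zero_of_mem_tsupport hx)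
  · rw [hardyRemainder_eq_zero hp1 hx, gradient_eq_zero hx, abs_rpow_eq_zero hp1 hx,
      hu.fderiv_abs_rpow_eq_zero hp1 hx, norm_zero, Real.zero_rpow (by linarith)]
    simp

lemma integrable_hardyRemainder (hu : IsTestFunction {0}ᶜ u) (hp1 : 1 < p) (hp : n < p) :
    Integrable (hardyRemainder p u) := by
  rw [hu.hardyRemainder_eq_fun hp1 hp]
  exact ((hu.integrable_gradient hp1).sub ((hu.integrable_weight hp1).const_mul _)).sub
    ((hu.integrable_cross hp1).const_mul _)

/-- The Hardy difference is the integral of the remainder, since the linear term of the Taylor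
expansion integrates to zero. -/
theorem hardyDifference_eq {Ω : Set (EuclideanSpace ℝ (Fin n))}
    (hu' : IsTestFunction (Ω \ {0}) u) (hp1 : 1 < p) (hp : n < p) :
    hardyDifference p Ω u = ∫ x, hardyRemainder p u x := by
  have hu : IsTestFunction {0}ᶜ u := hu'.mono fun x hx => hx.2
  have hout : ∀ x, x ∉ Ω → x ∉ tsupport u := fun x hx h => hx (hu'.tsupport_subset h).1
  have h0 : ∫ x, ‖x‖ ^ (-p) * (fderiv ℝ (fun x => |u x| ^ p) x x - (p - n) * |u x| ^ p) = 0 := by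
    simpa using hu.integral_radial_identity hp1 (θ := fun _ => 1) contDiffOn_const
  unfold hardyDifference
  rw [setIntegral_eq_integral_of_forall_compl_eq_zero fun x hx => by
      rw [gradient_eq_zero (hout x hx), norm_zero, Real.zero_rpow (by linarith)],
    setIntegral_eq_integral_of_forall_compl_eq_zero fun x hx => by
      rw [abs_rpow_eq_zero hp1 (hout x hx), zero_div]]
  rw [hu.hardyRemainder_eq_fun hp1 hp, integral_sub, integral_sub (hu.integrable_gradient hp1)
    ((hu.integrable_weight hp1).const_mul _), integral_const_mul, integral_const_mul, h0]
  · simp only [mul_zero, sub_zero]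
    congr 3
    ext x
    rw [Real.rpow_neg (norm_nonneg _), div_eq_inv_mul]
  · exact (hu.integrable_gradient hp1).sub ((hu.integrable_weight hp1).const_mul _)
  · exact (hu.integrable_cross hp1).const_mul _

end IsTestFunction
end
end

/-! ### Estimates on annuli -/

section
variable {n : ℕ} {u : EuclideanSpace ℝ (Fin n) → ℝ} {p : ℝ}

lemma abs_rpow_mul_inner_le {E : Type*} [NormedAddCommGroup E] [InnerProductSpace ℝ E]
    (p : ℝ) (a b : E) : |‖a‖ ^ (p - 2) * ⟪a, b⟫| ≤ ‖a‖ ^ (p - 1) * ‖b‖ := by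
  rcases eq_or_ne a 0 with rfl | ha
  · rw [inner_zero_left, mul_zero, abs_zero]; positivity
  have h : ‖a‖ ^ (p - 1) = ‖a‖ ^ (p - 2) * ‖a‖ := by
    rw [← Real.rpow_add_one (norm_ne_zero_iff.2 ha)]; congr 1; ring
  rw [abs_mul, abs_of_nonneg (by positivity), h, mul_assoc]
  gcongr
  exact abs_real_inner_le_norm a b

lemma IsTestFunction.integrable_radial (hu : IsTestFunction {0}ᶜ u) (hp : 1 < p) {θ : ℝ → ℝ}
    (hθ : ContDiffOn ℝ 1 θ (Set.Ioi 0)) :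
    Integrable fun x => ‖x‖ ^ (-p) *
      (θ ‖x‖ * (fderiv ℝ (fun x => |u x| ^ p) x x - (p - n) * |u x| ^ p)
        + ‖x‖ * deriv θ ‖x‖ * |u x| ^ p) := by
  refine hu.integrable (fun x hx => by
    rw [abs_rpow_eq_zero hp hx, hu.fderiv_abs_rpow_eq_zero hp hx]; simp) fun x hx => ?_
  have h1 := hu.contDiff_abs_rpow hp
  have h2 : Continuous fun x => fderiv ℝ (fun x => |u x| ^ p) x x :=
    (h1.continuous_fderiv one_ne_zero).clm_apply continuous_id
  have hx0 := norm_pos_iff.2 hx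
  have h3 : ContinuousAt (fun x : EuclideanSpace ℝ (Fin n) => θ ‖x‖) x :=
    ContinuousAt.comp (f := fun x : EuclideanSpace ℝ (Fin n) => ‖x‖)
      (hθ.continuousOn.continuousAt (Ioi_mem_nhds hx0)) continuous_norm.continuousAt
  have h4 : ContinuousAt (fun x : EuclideanSpace ℝ (Fin n) => deriv θ ‖x‖) x :=
    ContinuousAt.comp (f := fun x : EuclideanSpace ℝ (Fin n) => ‖x‖)
      ((hθ.continuousOn_deriv_of_isOpen isOpen_Ioi le_rfl).continuousAt (Ioi_mem_nhds hx0))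
      continuous_norm.continuousAt
  exact (continuous_norm.continuousAt.rpow_const (Or.inl hx0.ne')).mul
    ((h3.mul (h2.sub (continuous_const.mul h1.continuous)).continuousAt).add
      ((continuous_norm.continuousAt.mul h4).mul h1.continuous.continuousAt))

/-- The radial weight `θ(r) = (r / R) ^ κ * r / (R + r)`. With `κ⁻¹ = 1 + log (D / R)` it is bounded
by `e` for `r ≤ D`, and its logarithmic derivative `r θ' / θ = κ + R / (R + r)` is at least `κ`
everywhere and of order one for `r` of the order of `R`. -/
noncomputable def annulusWeight (κ R r : ℝ) : ℝ := (r / R) ^ κ * (r / (R + r))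

lemma contDiffOn_annulusWeight {κ R : ℝ} (hR : 0 < R) :
    ContDiffOn ℝ 1 (annulusWeight κ R) (Set.Ioi 0) := by
  intro r hr
  have hr : 0 < r := hr
  refine ContDiffAt.contDiffWithinAt ?_
  exact ((contDiffAt_id.div_const R).rpow_const_of_ne (div_pos hr hR).ne').mul
    (contDiffAt_id.div (contDiffAt_const.add contDiffAt_id) (by positivity : R + r ≠ 0))

lemma mul_deriv_annulusWeight {κ R r : ℝ} (hR : 0 < R) (hr : 0 < r) :
    r * deriv (annulusWeight κ R) r = annulusWeight κ R r * (κ + R / (R + r)) := by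
  have hRr : R + r ≠ 0 := by positivity
  have h1 : HasDerivAt (fun r : ℝ => (r / R) ^ κ) (1 / R * κ * (r / R) ^ (κ - 1)) r :=
    ((hasDerivAt_id r).div_const R).rpow_const (Or.inl (div_pos hr hR).ne')
  have h2 : HasDerivAt (fun r : ℝ => r / (R + r)) ((1 * (R + r) - r * 1) / (R + r) ^ 2) r :=
    (hasDerivAt_id r).div ((hasDerivAt_id r).const_add R) hRr
  have h3 : deriv (annulusWeight κ R) r = _ := (h1.mul h2).deriv
  rw [h3, annulusWeight, Real.rpow_sub_one (div_pos hr hR).ne']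
  field_simp
  ring

/-- The closed annulus `R / 2 ≤ |x| ≤ 3 * R / 2`. -/
def annulus (n : ℕ) (R : ℝ) : Set (EuclideanSpace ℝ (Fin n)) :=
  {x | R / 2 ≤ ‖x‖ ∧ ‖x‖ ≤ 3 * R / 2}

lemma measurableSet_annulus (R : ℝ) : MeasurableSet (annulus n R) :=
  ((isClosed_le continuous_const continuous_norm).inter
    (isClosed_le continuous_norm continuous_const)).measurableSet

lemma annulusWeight_bounds {D R r : ℝ} (hR : 0 < R) (hRD : R ≤ D) (hr : 0 < r) (hrD : r ≤ D) :
    0 < annulusWeight (1 + Real.log (D / R))⁻¹ R r ∧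
    annulusWeight (1 + Real.log (D / R))⁻¹ R r ≤ Real.exp 1 := by
  have hL : 0 ≤ Real.log (D / R) := Real.log_nonneg ((one_le_div hR).2 hRD)
  have hrR := div_pos hr hR
  refine ⟨by unfold annulusWeight; positivity, ?_⟩
  have h1 : r / (R + r) ≤ 1 := (div_le_one (by positivity)).2 (by linarith)
  have h2 : (r / R) ^ (1 + Real.log (D / R))⁻¹ ≤ Real.exp 1 := by
    calc (r / R) ^ (1 + Real.log (D / R))⁻¹ ≤ (D / R) ^ (1 + Real.log (D / R))⁻¹ := by gcongr
      _ = Real.exp (Real.log (D / R) * (1 + Real.log (D / R))⁻¹) :=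
          Real.rpow_def_of_pos (div_pos (by linarith) hR) _
      _ ≤ _ := by
        gcongr
        rw [← div_eq_mul_inv, div_le_one (by linarith)]; linarith
  calc _ ≤ Real.exp 1 * 1 := by unfold annulusWeight; gcongr
    _ = _ := mul_one _

lemma mul_deriv_annulusWeight_ge {κ R r : ℝ} (hR : 0 < R) (hκ0 : 0 ≤ κ) (hκ1 : κ ≤ 1)
    (h1 : R / 2 ≤ r) (h2 : r ≤ 3 * R / 2) :
    1 / 10 ≤ r * deriv (annulusWeight κ R) r := by
  have hr : 0 < r := by linarith
  rw [mul_deriv_annulusWeight hR hr, annulusWeight]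
  have hRr : 0 < R + r := by positivity
  have e1 : 1 / 2 ≤ (r / R) ^ κ := by
    have hh : (1 : ℝ) / 2 ≤ r / R := by rw [le_div_iff₀ hR]; linarith
    calc (1 : ℝ) / 2 = (1 / 2) ^ (1 : ℝ) := by rw [Real.rpow_one]
      _ ≤ (1 / 2 : ℝ) ^ κ := Real.rpow_le_rpow_of_exponent_ge (by norm_num) (by norm_num) hκ1
      _ ≤ _ := by gcongr
  have e2 : 1 / 5 ≤ r / (R + r) * (R / (R + r)) := by
    rw [div_mul_div_comm, div_le_div_iff₀ (by norm_num) (by positivity)]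
    nlinarith [mul_nonneg (sub_nonneg.2 h1) (sub_nonneg.2 h2)]
  calc (1 : ℝ) / 10 = 1 / 2 * (1 / 5) := by norm_num
    _ ≤ (r / R) ^ κ * (r / (R + r) * (R / (R + r))) := by gcongr
    _ = (r / R) ^ κ * (r / (R + r)) * (0 + R / (R + r)) := by ring
    _ ≤ _ := by gcongr

/-- On an annulus of radius `R`, the mass `∫ |u| ^ p / |x| ^ p` exceeds the Hardy difference by a
factor `1 + log (D / R)` at most. This is where the power `1 / p` of `X` comes from. The weight
`annulusWeight` in the radial identity bounds `∫ r θ' |u| ^ p / |x| ^ p` by the mixed term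
`∫ θ ‖a‖ ^ (p - 1) ‖b‖`, and the pointwise inequality with `ε` a small multiple of `r θ' / θ` lets one
half of the left side be absorbed, leaving `(θ / ε) ρ`, of order `(1 + log (D / R)) ρ`. -/
theorem exists_setIntegral_weight_annulus_le (n : ℕ) (hp1 : 1 < p) (hp : n < p) :
    ∃ C : ℝ, 0 < C ∧ ∀ (u : EuclideanSpace ℝ (Fin n) → ℝ) (D R : ℝ),
      IsTestFunction {0}ᶜ u → tsupport u ⊆ Metric.closedBall 0 D → 0 < R → R ≤ D →
      ∫ x in annulus n R, ‖x‖ ^ (-p) * |u x| ^ p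
        ≤ C * (1 + Real.log (D / R)) * ∫ x, hardyRemainder p u x := by
  obtain ⟨C₀, hC₀, hkey⟩ :=
    exists_mul_norm_rpow_le_powRemainder (E := EuclideanSpace ℝ (Fin n)) hp1
  have hp0 : 0 < p := by linarith
  set s := (p - n) / p with hs_def
  have hs : 0 < s := div_pos (by linarith) hp0
  set δ := min (1 / 2) (1 / (2 * (p * s)))
  have hδ : 0 < δ := lt_min (by norm_num) (by positivity)
  have hδ1 : δ ≤ 1 / 2 := min_le_left _ _
  have hδ2 : p * s * δ ≤ 1 / 2 := by
    have : δ ≤ 1 / (2 * (p * s)) := min_le_right _ _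
    rw [le_div_iff₀ (by positivity)] at this; linarith
  set c := s ^ (p - 1) with hc_def
  have hc : 0 < c := Real.rpow_pos_of_pos hs _
  refine ⟨20 * (p * c⁻¹ * C₀ * Real.exp 1 / δ), by positivity, fun u D R hu hsupp hR hRD => ?_⟩
  set T := 1 + Real.log (D / R)
  have hT : 1 ≤ T := by
    have : 0 ≤ Real.log (D / R) := Real.log_nonneg ((one_le_div hR).2 hRD)
    simp only [T]; linarith
  have hT0 : 0 < T := by linarith
  have hκ1 : T⁻¹ ≤ 1 := inv_le_one_of_one_le₀ hT
  set θ := annulusWeight T⁻¹ R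
  have hθ : ContDiffOn ℝ 1 θ (Set.Ioi 0) := contDiffOn_annulusWeight hR
  have hid := hu.integral_radial_identity hp1 hθ
  set K := p * c⁻¹ * C₀ * Real.exp 1 / δ with hK
  have hpt : ∀ x, (annulus n R).indicator (fun x => 1 / 20 * (‖x‖ ^ (-p) * |u x| ^ p)) x
      - K * T * hardyRemainder p u x ≤
      ‖x‖ ^ (-p) * (θ ‖x‖ * (fderiv ℝ (fun x => |u x| ^ p) x x - (p - n) * |u x| ^ p)
        + ‖x‖ * deriv θ ‖x‖ * |u x| ^ p) := by
    intro x
    by_cases hxs : x ∈ tsupport u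
    swap
    · rw [hardyRemainder_eq_zero hp1 hxs, IsTestFunction.abs_rpow_eq_zero hp1 hxs,
        hu.fderiv_abs_rpow_eq_zero hp1 hxs]
      have : (annulus n R).indicator (fun x => 1 / 20 * (‖x‖ ^ (-p) * |u x| ^ p)) x = 0 := by
        refine Set.indicator_apply_eq_zero.2 fun _ => ?_
        rw [IsTestFunction.abs_rpow_eq_zero hp1 hxs]; simp
      rw [this]; simp
    have hx := hu.ne_zero_of_mem_tsupport hxs
    have hr := norm_pos_iff.2 hx
    have hrD : ‖x‖ ≤ D := by simpa using hsupp hxs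
    obtain ⟨hθ0, hθ1⟩ := annulusWeight_bounds hR hRD hr hrD
    have hθ0 : 0 < θ ‖x‖ := hθ0
    have hθ1 : θ ‖x‖ ≤ Real.exp 1 := hθ1
    have hder : ‖x‖ * deriv θ ‖x‖ = θ ‖x‖ * (T⁻¹ + R / (R + ‖x‖)) := mul_deriv_annulusWeight hR hr
    set t := θ ‖x‖
    set w := T⁻¹ + R / (R + ‖x‖) with hw
    have hRx : R / (R + ‖x‖) ≤ 1 := (div_le_one (by positivity)).2 (by linarith)
    have hRx0 : 0 < R / (R + ‖x‖) := by positivity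
    have hTi : 0 < T⁻¹ := by positivity
    have hw0 : 0 < w := by positivity
    set H := ‖x‖ ^ (-p) * |u x| ^ p with hH
    have hH0 : 0 ≤ H := by positivity
    set ρ := hardyRemainder p u x with hρ
    have hρ0 : 0 ≤ ρ := hardyRemainder_nonneg hp1 x
    set W := ‖x‖ ^ (-p) * (fderiv ℝ (fun x => |u x| ^ p) x x - (p - n) * |u x| ^ p) with hW
    have hcross : p * ‖hardyField p u x‖ ^ (p - 2) *
        ⟪hardyField p u x, ∇ u x - hardyField p u x⟫ = c * W :=
      hardyField_cross_term hu hp1 hp hx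
    have hnorm : ‖hardyField p u x‖ ^ p = c * s * H := by
      have e : c * s = s ^ p := by rw [hc_def, ← Real.rpow_add_one hs.ne', sub_add_cancel]
      rw [norm_hardyField_rpow hp hx, ← hs_def, e, hH]
      ring
    set a := hardyField p u x
    set b := ∇ u x - a
    have hCS : -(c * W) ≤ p * (‖a‖ ^ (p - 1) * ‖b‖) := by
      rw [← hcross, mul_assoc, ← mul_neg]
      gcongr
      exact (neg_le_abs _).trans (abs_rpow_mul_inner_le p a b)
    -- `δ` is small enough for half of `r θ' H = t * w * H` to absorb the term `ε * ‖a‖ ^ p`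
    set ε := δ * w
    have hε0 : 0 < ε := by positivity
    have hε1 : ε ≤ 1 := by
      have : w ≤ 2 := by linarith
      calc δ * w ≤ 1 / 2 * 2 := by gcongr
        _ = 1 := by norm_num
    have hk : ‖a‖ ^ (p - 1) * ‖b‖ ≤ ε * (c * s * H) + C₀ / ε * ρ := by
      have := hkey a b ε hε0 hε1
      rw [hnorm] at this
      refine le_of_mul_le_mul_left (this.trans_eq ?_) hε0
      have : powRemainder p a b = ρ := rfl
      rw [this]; field_simp
    -- `t / ε ≤ exp 1 * T / δ`, because `ε ≥ δ / T`
    have hTε : t * (C₀ / ε) ≤ Real.exp 1 * (C₀ / δ * T) := by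
      have h1 : C₀ / ε ≤ C₀ / δ * T := by
        rw [div_mul_eq_mul_div, div_le_div_iff₀ hε0 hδ]
        have : 1 ≤ T * w := by
          calc 1 = T * T⁻¹ := (mul_inv_cancel₀ hT0.ne').symm
            _ ≤ T * w := by gcongr; linarith
        calc C₀ * δ = C₀ * δ * 1 := by ring
          _ ≤ C₀ * δ * (T * w) := by gcongr
          _ = _ := by ring
      gcongr
    have hmain : -(t * W) ≤ 1 / 2 * (t * w * H) + K * T * ρ := by
      have h1 : -W ≤ c⁻¹ * (p * (ε * (c * s * H) + C₀ / ε * ρ)) := by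
        rw [inv_mul_eq_div, le_div_iff₀ hc]
        have : p * (‖a‖ ^ (p - 1) * ‖b‖) ≤ p * (ε * (c * s * H) + C₀ / ε * ρ) := by gcongr
        linarith
      calc -(t * W) = t * -W := by ring
        _ ≤ t * (c⁻¹ * (p * (ε * (c * s * H) + C₀ / ε * ρ))) := by gcongr
        _ = (p * s * δ) * (t * w * H) + p * c⁻¹ * (t * (C₀ / ε)) * ρ := by
          simp only [ε]; field_simp
        _ ≤ 1 / 2 * (t * w * H) + p * c⁻¹ * (Real.exp 1 * (C₀ / δ * T)) * ρ := by gcongr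
        _ = _ := by rw [hK]; ring
    have hrhs : ‖x‖ ^ (-p) * (t * (fderiv ℝ (fun x => |u x| ^ p) x x - (p - n) * |u x| ^ p)
        + ‖x‖ * deriv θ ‖x‖ * |u x| ^ p) = t * W + t * w * H := by rw [hder, hW, hH]; ring
    rw [hrhs]
    have hind : (annulus n R).indicator (fun x => 1 / 20 * (‖x‖ ^ (-p) * |u x| ^ p)) x
        ≤ 1 / 2 * (t * w * H) := by
      by_cases hxA : x ∈ annulus n R
      · rw [Set.indicator_of_mem hxA, ← hder, ← hH]
        have := mul_deriv_annulusWeight_ge (κ := T⁻¹) hR hTi.le hκ1 hxA.1 hxA.2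
        have h2 : 1 / 10 * H ≤ ‖x‖ * deriv θ ‖x‖ * H := by gcongr
        linarith
      · rw [Set.indicator_of_notMem hxA]; positivity
    linarith
  have hi1 := ((hu.integrable_weight hp1).const_mul (1 / 20)).indicator
    (measurableSet_annulus (n := n) R)
  have hi2 := (hu.integrable_hardyRemainder hp1 hp).const_mul (K * T)
  have := integral_mono (hi1.sub hi2) (hu.integrable_radial hp1 hθ) hpt
  rw [hid] at this
  simp only [Pi.sub_apply] at this
  rw [integral_sub hi1 hi2, integral_indicator (measurableSet_annulus R), integral_const_mul,
    integral_const_mul] at this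
  linarith

/-- The gradient is bounded on the annulus because `|∇ u| ^ p` is the sum of `‖a‖ ^ p`, the linear
term and the remainder, and the linear term is controlled by the other two. -/
theorem exists_setIntegral_gradient_annulus_le (n : ℕ) (hp1 : 1 < p) (hp : n < p) :
    ∃ C : ℝ, 0 < C ∧ ∀ (u : EuclideanSpace ℝ (Fin n) → ℝ) (D R : ℝ),
      IsTestFunction {0}ᶜ u → tsupport u ⊆ Metric.closedBall 0 D → 0 < R → R ≤ D →
      ∫ x in annulus n R, ‖∇ u x‖ ^ p
        ≤ C * (1 + Real.log (D / R)) * ∫ x, hardyRemainder p u x := by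
  obtain ⟨C₁, hC₁, hw⟩ := exists_setIntegral_weight_annulus_le n hp1 hp
  obtain ⟨C₀, hC₀, hkey⟩ :=
    exists_mul_norm_rpow_le_powRemainder (E := EuclideanSpace ℝ (Fin n)) hp1
  have hp0 : 0 < p := by linarith
  set s := (p - n) / p with hs_def
  have hs : 0 < s := div_pos (by linarith) hp0
  refine ⟨(1 + p) * s ^ p * C₁ + (p * C₀ + 1), by positivity,
    fun u D R hu hsupp hR hRD => ?_⟩
  set T := 1 + Real.log (D / R)
  have hT : 1 ≤ T := by
    have : 0 ≤ Real.log (D / R) := Real.log_nonneg ((one_le_div hR).2 hRD)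
    simp only [T]; linarith
  have hpt : ∀ x, ‖∇ u x‖ ^ p ≤ (1 + p) * s ^ p * (‖x‖ ^ (-p) * |u x| ^ p)
      + (p * C₀ + 1) * hardyRemainder p u x := by
    intro x
    by_cases hxs : x ∈ tsupport u
    swap
    · rw [IsTestFunction.gradient_eq_zero hxs, norm_zero, Real.zero_rpow hp0.ne']
      have := hardyRemainder_nonneg (u := u) hp1 x
      positivity
    have hx := hu.ne_zero_of_mem_tsupport hxs
    have hn := norm_hardyField_rpow (u := u) hp hx p
    have hk := hkey (hardyField p u x) (∇ u x - hardyField p u x) 1 one_pos le_rfl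
    have hρ : powRemainder p (hardyField p u x) (∇ u x - hardyField p u x)
      = hardyRemainder p u x := rfl
    have hdef := hρ
    rw [powRemainder, add_sub_cancel] at hdef
    rw [hρ] at hk
    set a := hardyField p u x
    set b := ∇ u x - a
    have hCS : p * ‖a‖ ^ (p - 2) * ⟪a, b⟫ ≤ p * (‖a‖ ^ (p - 1) * ‖b‖) := by
      rw [mul_assoc]
      exact mul_le_mul_of_nonneg_left
        ((le_abs_self _).trans (abs_rpow_mul_inner_le p a b)) hp0.le
    have h3 : p * (1 * (‖a‖ ^ (p - 1) * ‖b‖)) ≤ p * (1 ^ 2 * ‖a‖ ^ p + C₀ * hardyRemainder p u x) :=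
      by gcongr
    have h4 : ‖a‖ ^ p = s ^ p * (‖x‖ ^ (-p) * |u x| ^ p) := by rw [hn]; ring
    have : ‖∇ u x‖ ^ p ≤ (1 + p) * ‖a‖ ^ p + (p * C₀ + 1) * hardyRemainder p u x := by linarith
    rw [h4] at this
    linarith
  have hI := hu.integrable_hardyRemainder hp1 hp
  have hW := hu.integrable_weight hp1
  have hI0 : 0 ≤ ∫ x, hardyRemainder p u x :=
    integral_nonneg fun x => hardyRemainder_nonneg hp1 x
  have hρA : ∫ x in annulus n R, hardyRemainder p u x ≤ T * ∫ x, hardyRemainder p u x :=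
    (setIntegral_le_integral hI (ae_of_all _ fun x => hardyRemainder_nonneg hp1 x)).trans
      (le_mul_of_one_le_left hI0 hT)
  calc ∫ x in annulus n R, ‖∇ u x‖ ^ p
      ≤ ∫ x in annulus n R, ((1 + p) * s ^ p * (‖x‖ ^ (-p) * |u x| ^ p)
      + (p * C₀ + 1) * hardyRemainder p u x) :=
        integral_mono (hu.integrable_gradient hp1).integrableOn
          ((hW.const_mul _).add (hI.const_mul _)).integrableOn hpt
    _ = (1 + p) * s ^ p * (∫ x in annulus n R, ‖x‖ ^ (-p) * |u x| ^ p)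
        + (p * C₀ + 1) * ∫ x in annulus n R, hardyRemainder p u x := by
        rw [integral_add (hW.const_mul _).integrableOn (hI.const_mul _).integrableOn,
          integral_const_mul, integral_const_mul]
    _ ≤ (1 + p) * s ^ p * (C₁ * T * ∫ x, hardyRemainder p u x)
        + (p * C₀ + 1) * (T * ∫ x, hardyRemainder p u x) := by
        gcongr
        exact hw u D R hu hsupp hR hRD
    _ = _ := by ring

end

/-! ### Morrey's inequality on balls -/

section

/-- Hölder's inequality on a compact set, against the constant function one. -/
lemma setIntegral_le_volume_rpow_mul {E : Type*} [TopologicalSpace E] [T2Space E]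
    [MeasurableSpace E] [BorelSpace E] {μ : Measure E} [IsFiniteMeasureOnCompacts μ] {K : Set E}
    (hK : IsCompact K) {f : E → ℝ} (hf : ContinuousOn f K) (hf0 : ∀ x ∈ K, 0 ≤ f x)
    {p : ℝ} (hp : 1 < p) :
    ∫ x in K, f x ∂μ ≤ μ.real K ^ (1 - 1 / p) * (∫ x in K, f x ^ p ∂μ) ^ (1 / p) := by
  have hpq := Real.HolderConjugate.conjExponent hp
  have hfin : IsFiniteMeasure (μ.restrict K) := ⟨by
    rw [Measure.restrict_apply_univ]; exact hK.measure_lt_top⟩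
  obtain ⟨M, hM⟩ := hK.exists_bound_of_continuousOn hf
  have hmem : MemLp f (ENNReal.ofReal p) (μ.restrict K) :=
    MemLp.of_bound (hf.aestronglyMeasurable_of_isCompact hK hK.measurableSet) M
      ((ae_restrict_mem hK.measurableSet).mono hM)
  have h := integral_mul_le_Lp_mul_Lq_of_nonneg (μ := μ.restrict K) hpq
    (f := f) (g := fun _ => 1)
    ((ae_restrict_mem hK.measurableSet).mono hf0) (ae_of_all _ fun _ => zero_le_one) hmem
    (memLp_const 1)
  have e : 1 - 1 / p = 1 / p.conjExponent := by
    have := hpq.inv_add_inv_eq_one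
    simp only [one_div]; linarith
  rw [e]
  simpa [mul_comm] using h

variable {n : ℕ}

/-- Change of variables for the contraction of a convex set towards one of its points. -/
lemma setIntegral_comp_homothety_le {B : Set (EuclideanSpace ℝ (Fin n))} (hB : Convex ℝ B)
    (hBc : IsCompact B) {x : EuclideanSpace ℝ (Fin n)} (hx : x ∈ B) {f : EuclideanSpace ℝ (Fin n) → ℝ}
    (hf : Continuous f) (hf0 : ∀ y, 0 ≤ f y) {t : ℝ} (ht0 : 0 < t) (ht1 : t ≤ 1) :
    ∫ z in B, f (x + t • (z - x)) ≤ (t ^ n)⁻¹ * ∫ z in B, f z := by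
  have hmB := hBc.measurableSet
  have hg : Integrable (B.indicator f) :=
    (integrable_indicator_iff hmB).2 (hf.continuousOn.integrableOn_compact hBc)
  have hg' : Integrable fun z => B.indicator f (x + t • (z - x)) := by
    have h1 : Integrable fun z => B.indicator f (t • z + (x - t • x)) :=
      (hg.comp_add_right (x - t • x)).comp_smul ht0.ne'
    convert h1 using 2 with z
    congr 1; module
  have hI : ∫ z, B.indicator f (x + t • (z - x)) = (t ^ n)⁻¹ * ∫ z in B, f z := by
    have h1 : ∀ z, B.indicator f (x + t • (z - x))
        = (fun y => B.indicator f (y + (x - t • x))) (t • z) := fun z => by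
      simp only; congr 1; module
    rw [integral_congr_ae (ae_of_all _ h1), Measure.integral_comp_smul_of_nonneg volume
      (fun y => B.indicator f (y + (x - t • x))) (hR := ht0.le), finrank_euclideanSpace_fin,
      integral_add_right_eq_self (B.indicator f), integral_indicator hmB, smul_eq_mul]
  rw [← hI, ← integral_indicator hmB]
  refine integral_mono ((integrable_indicator_iff hmB).2
    ((by fun_prop : Continuous fun z => f (x + t • (z - x))).continuousOn.integrableOn_compact hBc))
    hg' fun z => ?_
  by_cases hz : z ∈ B
  · have : x + t • (z - x) ∈ B := hB.add_smul_sub_mem hx hz ⟨ht0.le, ht1⟩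
    rw [Set.indicator_of_mem hz, Set.indicator_of_mem this]
  · rw [Set.indicator_of_notMem hz]
    exact Set.indicator_nonneg (fun y _ => hf0 y) _

lemma abs_sub_le_integral_gradient {u : EuclideanSpace ℝ (Fin n) → ℝ} (hu : ContDiff ℝ 1 u)
    (hgc : Continuous (∇ u)) (x z : EuclideanSpace ℝ (Fin n)) :
    |u z - u x| ≤ ‖z - x‖ * ∫ t in Set.Icc (0 : ℝ) 1, ‖∇ u (x + t • (z - x))‖ := by
  have hd : ∀ t : ℝ, HasDerivAt (fun t : ℝ => u (x + t • (z - x)))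
      (⟪∇ u (x + t • (z - x)), z - x⟫) t := fun t => by
    have h1 : HasDerivAt (fun t : ℝ => x + t • (z - x)) (z - x) t := by
      simpa using ((hasDerivAt_id t).smul_const (z - x)).const_add x
    rw [inner_gradient_left]
    exact (hu.differentiable one_ne_zero _).hasFDerivAt.comp_hasDerivAt t h1
  have hg : Continuous fun t : ℝ => ∇ u (x + t • (z - x)) := hgc.comp (by fun_prop)
  have hc : Continuous fun t : ℝ => ⟪∇ u (x + t • (z - x)), z - x⟫ := hg.inner continuous_const
  have hftc := intervalIntegral.integral_eq_sub_of_hasDerivAt (a := 0) (b := 1)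
    (fun t _ => hd t) (hc.intervalIntegrable _ _)
  simp only [one_smul, zero_smul, add_zero, add_sub_cancel] at hftc
  rw [← hftc, integral_Icc_eq_integral_Ioc, ← intervalIntegral.integral_of_le zero_le_one,
    ← intervalIntegral.integral_const_mul, ← Real.norm_eq_abs]
  refine intervalIntegral.norm_integral_le_of_norm_le zero_le_one (ae_of_all _ fun t _ => ?_)
    ((hg.norm.const_mul _).intervalIntegrable _ _)
  rw [mul_comm]
  exact norm_inner_le_norm _ _

/-- Morrey's inequality on a ball. After integration along segments from `x` and Fubini, the
homothety of ratio `t` costs a factor `t ^ (-n / p)`, which is integrable as `n < p`. -/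
theorem setIntegral_abs_sub_le {p : ℝ} (hp1 : 1 < p) (hp : n < p)
    {u : EuclideanSpace ℝ (Fin n) → ℝ} (hu : ContDiff ℝ 1 u) (hgc : Continuous (∇ u))
    {x₀ x : EuclideanSpace ℝ (Fin n)} {r : ℝ} (hx : x ∈ Metric.closedBall x₀ r) :
    ∫ z in Metric.closedBall x₀ r, |u z - u x| ≤
      2 * r / (1 - n / p) * (volume.real (Metric.closedBall x₀ r) ^ (1 - 1 / p) *
        (∫ z in Metric.closedBall x₀ r, ‖∇ u z‖ ^ p) ^ (1 / p)) := by
  set B := Metric.closedBall x₀ r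
  have hB : Convex ℝ B := convex_closedBall _ _
  have hBc : IsCompact B := isCompact_closedBall _ _
  have hmB : MeasurableSet B := hBc.measurableSet
  have hp0 : 0 < p := by linarith
  set J := ∫ z in B, ‖∇ u z‖ ^ p
  have hJ0 : 0 ≤ J := integral_nonneg fun z => by positivity
  set V := volume.real B
  have hr0 : 0 ≤ r := dist_nonneg.trans hx
  set Φ : EuclideanSpace ℝ (Fin n) → ℝ → ℝ := fun z t => ‖∇ u (x + t • (z - x))‖ with hΦ
  have hΦc : Continuous (Function.uncurry Φ) := by
    simp only [hΦ, Function.uncurry_def]; fun_prop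
  have hline : ∀ z ∈ B, |u z - u x| ≤ 2 * r * ∫ t in Set.Icc (0 : ℝ) 1, Φ z t := by
    intro z hz
    have hzx : ‖z - x‖ ≤ 2 * r := by
      rw [← dist_eq_norm]
      have := dist_triangle_right z x x₀
      have h1 : dist z x₀ ≤ r := hz
      have h2 : dist x x₀ ≤ r := hx
      linarith
    exact (abs_sub_le_integral_gradient hu hgc x z).trans
      (mul_le_mul_of_nonneg_right hzx (integral_nonneg fun t => norm_nonneg _))
  have hint : Integrable (Function.uncurry Φ)
      ((volume.restrict B).prod (volume.restrict (Set.Icc (0 : ℝ) 1))) := by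
    rw [Measure.prod_restrict]
    exact hΦc.continuousOn.integrableOn_compact (hBc.prod isCompact_Icc)
  have hinner : ∀ t ∈ Set.Ioc (0 : ℝ) 1,
      ∫ z in B, Φ z t ≤ V ^ (1 - 1 / p) * J ^ (1 / p) * t ^ (-(n / p : ℝ)) := by
    intro t ht
    have h1 := setIntegral_le_volume_rpow_mul (μ := volume) hBc (f := fun z => Φ z t)
      (hΦc.comp (Continuous.prodMk_left t)).continuousOn (fun z _ => norm_nonneg _) hp1
    have h2 := setIntegral_comp_homothety_le hB hBc hx (f := fun y => ‖∇ u y‖ ^ p)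
      (hgc.norm.rpow_const fun _ => Or.inr hp0.le) (fun y => by positivity) ht.1 ht.2
    refine h1.trans ?_
    rw [mul_assoc]
    refine mul_le_mul_of_nonneg_left ?_ (by positivity)
    calc (∫ z in B, Φ z t ^ p) ^ (1 / p) ≤ ((t ^ n)⁻¹ * J) ^ (1 / p) := by
          refine Real.rpow_le_rpow (integral_nonneg fun z => ?_) h2 (by positivity)
          exact Real.rpow_nonneg (norm_nonneg _) _
      _ = J ^ (1 / p) * t ^ (-(n / p : ℝ)) := by
          rw [Real.mul_rpow (by have := ht.1; positivity) hJ0, mul_comm, ← Real.rpow_natCast,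
            ← Real.rpow_neg ht.1.le, ← Real.rpow_mul ht.1.le]
          congr 2; ring
  have hnp : -1 < -(n / p : ℝ) := by
    have : (n : ℝ) / p < 1 := (div_lt_one hp0).2 hp
    linarith
  calc ∫ z in B, |u z - u x| ≤ ∫ z in B, 2 * r * ∫ t in Set.Icc (0 : ℝ) 1, Φ z t := by
        refine setIntegral_mono_on ?_ ?_ hmB hline
        · exact (by have := hu.continuous; fun_prop :
            Continuous fun z => |u z - u x|).continuousOn.integrableOn_compact hBc
        · exact hint.integral_prod_left.const_mul _
    _ = 2 * r * ∫ t in Set.Icc (0 : ℝ) 1, ∫ z in B, Φ z t := by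
        rw [integral_const_mul, integral_integral_swap hint]
    _ ≤ 2 * r * ∫ t in (0 : ℝ)..1, V ^ (1 - 1 / p) * J ^ (1 / p) * t ^ (-(n / p : ℝ)) := by
        refine mul_le_mul_of_nonneg_left ?_ (by positivity)
        rw [integral_Icc_eq_integral_Ioc, intervalIntegral.integral_of_le zero_le_one]
        refine setIntegral_mono_on ?_ ?_ measurableSet_Ioc hinner
        · exact IntegrableOn.mono_set (t := Set.Icc 0 1) hint.integral_prod_right
            Set.Ioc_subset_Icc_self
        · exact ((intervalIntegrable_iff_integrableOn_Ioc_of_le zero_le_one).1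
            (intervalIntegral.intervalIntegrable_rpow' hnp)).const_mul _
    _ = _ := by
        rw [intervalIntegral.integral_const_mul, integral_rpow (Or.inl hnp), Real.one_rpow,
          Real.zero_rpow (by linarith)]
        rw [sub_zero, neg_add_eq_sub]
        ring

end

/-! ### The Hardy–Morrey inequality -/

section
variable {n : ℕ} {p : ℝ}

lemma volume_real_unit_ball_pos (n : ℕ) :
    0 < volume.real (Metric.ball (0 : EuclideanSpace ℝ (Fin n)) 1) :=
  ENNReal.toReal_pos (Metric.measure_ball_pos _ _ one_pos).ne' measure_ball_lt_top.ne

/-- Passage from integrals to means over a ball, with the volume of the ball written out. -/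
lemma le_of_volume_closedBall_mul_le {x₀ : EuclideanSpace ℝ (Fin n)} {r A K : ℝ}
    (hr : 0 < r) (h : volume.real (Metric.closedBall x₀ r) * A ≤
      volume.real (Metric.closedBall x₀ r) ^ (1 - 1 / p) * K) :
    A ≤ volume.real (Metric.ball (0 : EuclideanSpace ℝ (Fin n)) 1) ^ (-(1 / p)) *
      r ^ (-(n / p : ℝ)) * K := by
  set v := volume.real (Metric.ball (0 : EuclideanSpace ℝ (Fin n)) 1)
  have hv : 0 < v := volume_real_unit_ball_pos n
  have hV : volume.real (Metric.closedBall x₀ r) = r ^ n * v := by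
    rw [Measure.addHaar_real_closedBall _ _ hr.le, finrank_euclideanSpace_fin]
  rw [hV] at h
  have hpos : 0 < r ^ n * v := by positivity
  rw [show 1 - 1 / p = 1 + -(1 / p) by ring, Real.rpow_add hpos, Real.rpow_one,
    mul_assoc (r ^ n * v)] at h
  have h2 := le_of_mul_le_mul_left h hpos
  rw [Real.mul_rpow (by positivity) hv.le, ← Real.rpow_natCast, ← Real.rpow_mul hr.le] at h2
  refine h2.trans_eq ?_
  rw [mul_comm (v ^ _), show (n : ℝ) * -(1 / p) = -(n / p : ℝ) by ring]

lemma closedBall_subset_annulus {x : EuclideanSpace ℝ (Fin n)} {r : ℝ} (hr : r ≤ ‖x‖ / 2) :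
    Metric.closedBall x r ⊆ annulus n ‖x‖ := by
  intro z hz
  rw [Metric.mem_closedBall, dist_eq_norm] at hz
  have h1 := norm_sub_norm_le x z
  have h2 := norm_sub_norm_le z x
  rw [norm_sub_rev] at h1
  exact ⟨by linarith, by linarith⟩

/-- Morrey's inequality on the ball of centre `x` and radius `|x - y|`, which stays in the annulus
of radius `|x|`. -/
theorem exists_abs_sub_le_of_le_half_norm (n : ℕ) (hp1 : 1 < p) (hp : n < p) :
    ∃ C : ℝ, 0 < C ∧ ∀ (u : EuclideanSpace ℝ (Fin n) → ℝ) (D : ℝ),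
      IsTestFunction {0}ᶜ u → tsupport u ⊆ Metric.closedBall 0 D →
      ∀ (x y : EuclideanSpace ℝ (Fin n)), x ≠ y → ‖x‖ ≤ D → ‖x - y‖ ≤ ‖x‖ / 2 →
      |u x - u y| ≤ C * ‖x - y‖ ^ (1 - n / p : ℝ) *
        ((1 + Real.log (D / ‖x‖)) * ∫ z, hardyRemainder p u z) ^ (1 / p) := by
  obtain ⟨C₂, hC₂, hgrad⟩ := exists_setIntegral_gradient_annulus_le n hp1 hp
  have hp0 : 0 < p := by linarith
  have hs : 0 < 1 - (n : ℝ) / p := by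
    have : (n : ℝ) / p < 1 := (div_lt_one hp0).2 hp
    linarith
  set v := volume.real (Metric.ball (0 : EuclideanSpace ℝ (Fin n)) 1)
  have hv : 0 < v := volume_real_unit_ball_pos n
  refine ⟨v ^ (-(1 / p)) * (4 / (1 - n / p)) * C₂ ^ (1 / p), by positivity, ?_⟩
  intro u D hu hsupp x y hxy hxD hd
  set r := ‖x - y‖
  have hr : 0 < r := norm_pos_iff.2 (sub_ne_zero.2 hxy)
  have hx : 0 < ‖x‖ := by linarith
  set T := 1 + Real.log (D / ‖x‖)
  have hT : 0 ≤ T := by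
    have : 0 ≤ Real.log (D / ‖x‖) := Real.log_nonneg ((one_le_div hx).2 hxD)
    simp only [T]; linarith
  set I := ∫ z, hardyRemainder p u z
  have hI0 : 0 ≤ I := integral_nonneg fun z => hardyRemainder_nonneg hp1 z
  set B := Metric.closedBall x r
  have hu1 : ContDiff ℝ 1 u := hu.contDiff.of_le (by norm_cast)
  have hxB : x ∈ B := Metric.mem_closedBall_self hr.le
  have hyB : y ∈ B := by rw [Metric.mem_closedBall, dist_comm, dist_eq_norm]
  set J := ∫ z in B, ‖∇ u z‖ ^ p
  have hJ : J ≤ C₂ * T * I :=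
    (setIntegral_mono_set (hu.integrable_gradient hp1).integrableOn
      (ae_of_all _ fun z => by positivity)
      (closedBall_subset_annulus hd).eventuallyLE).trans (hgrad u D ‖x‖ hu hsupp hx hxD)
  have hJ0 : 0 ≤ J := integral_nonneg fun z => by positivity
  have h1 := setIntegral_abs_sub_le hp1 hp hu1 hu.continuous_gradient hxB
  have h2 := setIntegral_abs_sub_le hp1 hp hu1 hu.continuous_gradient hyB
  have hi : ∀ w, IntegrableOn (fun z => |u z - u w|) B := fun w =>
    (hu1.continuous.sub continuous_const).abs.continuousOn.integrableOn_compact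
      (isCompact_closedBall _ _)
  have h3 : volume.real B * |u x - u y| ≤
      (∫ z in B, |u z - u x|) + ∫ z in B, |u z - u y| := by
    rw [← smul_eq_mul, ← setIntegral_const, ← integral_add (hi x) (hi y)]
    refine integral_mono (integrableOn_const (isCompact_closedBall _ _).measure_ne_top)
      ((hi x).add (hi y)) fun z => ?_
    have := abs_sub_le (u x) (u z) (u y)
    rwa [abs_sub_comm (u x) (u z)] at this
  have h4 := le_of_volume_closedBall_mul_le (K := 4 * r / (1 - n / p) * J ^ (1 / p)) hr
    (h3.trans ((add_le_add h1 h2).trans_eq (by ring)))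
  refine h4.trans ?_
  have hJp : J ^ (1 / p) ≤ C₂ ^ (1 / p) * (T * I) ^ (1 / p) := by
    rw [← Real.mul_rpow hC₂.le (by positivity), ← mul_assoc]
    exact Real.rpow_le_rpow hJ0 hJ (by positivity)
  have hrs : r ^ (1 - n / p : ℝ) = r ^ (-(n / p : ℝ)) * r := by
    rw [← Real.rpow_add_one hr.ne']; congr 1; ring
  rw [hrs]
  calc v ^ (-(1 / p)) * r ^ (-(n / p : ℝ)) * (4 * r / (1 - n / p) * J ^ (1 / p))
      ≤ v ^ (-(1 / p)) * r ^ (-(n / p : ℝ)) *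
        (4 * r / (1 - n / p) * (C₂ ^ (1 / p) * (T * I) ^ (1 / p))) := by gcongr
    _ = _ := by ring

/-- The value at `x` is bounded by the mean of `|u|` over the ball of radius `|x| / 2` plus the
oscillation on that ball, and both are controlled by the annulus estimates. -/
theorem exists_abs_le_norm_rpow (n : ℕ) (hp1 : 1 < p) (hp : n < p) :
    ∃ C : ℝ, 0 < C ∧ ∀ (u : EuclideanSpace ℝ (Fin n) → ℝ) (D : ℝ),
      IsTestFunction {0}ᶜ u → tsupport u ⊆ Metric.closedBall 0 D →
      ∀ x : EuclideanSpace ℝ (Fin n), x ≠ 0 → ‖x‖ ≤ D →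
      |u x| ≤ C * (‖x‖ ^ (1 - n / p : ℝ) *
        ((1 + Real.log (D / ‖x‖)) * ∫ z, hardyRemainder p u z) ^ (1 / p)) := by
  obtain ⟨C₁, hC₁, hweight⟩ := exists_setIntegral_weight_annulus_le n hp1 hp
  obtain ⟨C₂, hC₂, hgrad⟩ := exists_setIntegral_gradient_annulus_le n hp1 hp
  have hp0 : 0 < p := by linarith
  have hs : 0 < 1 - (n : ℝ) / p := by
    have : (n : ℝ) / p < 1 := (div_lt_one hp0).2 hp
    linarith
  set v := volume.real (Metric.ball (0 : EuclideanSpace ℝ (Fin n)) 1)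
  have hv : 0 < v := volume_real_unit_ball_pos n
  refine ⟨v ^ (-(1 / p)) * (1 / 2) ^ (-(n / p : ℝ)) *
    (2 * C₁ ^ (1 / p) + 1 / (1 - n / p) * C₂ ^ (1 / p)), by positivity, ?_⟩
  intro u D hu hsupp x hx0 hxD
  have hx : 0 < ‖x‖ := norm_pos_iff.2 hx0
  set r := ‖x‖ / 2 with hr_def
  have hr : 0 < r := by positivity
  set T := 1 + Real.log (D / ‖x‖)
  have hT : 0 ≤ T := by
    have : 0 ≤ Real.log (D / ‖x‖) := Real.log_nonneg ((one_le_div hx).2 hxD)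
    simp only [T]; linarith
  set I := ∫ z, hardyRemainder p u z
  have hI0 : 0 ≤ I := integral_nonneg fun z => hardyRemainder_nonneg hp1 z
  set B := Metric.closedBall x r
  have hBA : B ⊆ annulus n ‖x‖ := closedBall_subset_annulus le_rfl
  have hBc : IsCompact B := isCompact_closedBall _ _
  have hu1 : ContDiff ℝ 1 u := hu.contDiff.of_le (by norm_cast)
  have hxB : x ∈ B := Metric.mem_closedBall_self hr.le
  set J := ∫ z in B, ‖∇ u z‖ ^ p
  have hJ0 : 0 ≤ J := integral_nonneg fun z => by positivity
  have hJ : J ^ (1 / p) ≤ C₂ ^ (1 / p) * (T * I) ^ (1 / p) := by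
    rw [← Real.mul_rpow hC₂.le (by positivity), ← mul_assoc]
    refine Real.rpow_le_rpow hJ0 ?_ (by positivity)
    exact (setIntegral_mono_set (hu.integrable_gradient hp1).integrableOn
      (ae_of_all _ fun z => by positivity) hBA.eventuallyLE).trans (hgrad u D ‖x‖ hu hsupp hx hxD)
  set G := ∫ z in B, |u z| ^ p
  have hG0 : 0 ≤ G := integral_nonneg fun z => by positivity
  have hiG : IntegrableOn (fun z => |u z| ^ p) B :=
    (hu.contDiff_abs_rpow hp1).continuous.continuousOn.integrableOn_compact hBc
  have hG : G ≤ (2 * ‖x‖) ^ p * (C₁ * T * I) := by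
    calc G ≤ ∫ z in B, (2 * ‖x‖) ^ p * (‖z‖ ^ (-p) * |u z| ^ p) := by
          refine setIntegral_mono_on hiG ((hu.integrable_weight hp1).const_mul _).integrableOn
            hBc.measurableSet fun z hz => ?_
          have h1 := hBA hz
          have hz0 : 0 < ‖z‖ := by have := h1.1; linarith
          have h2 : 1 ≤ (2 * ‖x‖) ^ p * ‖z‖ ^ (-p) := by
            rw [Real.rpow_neg hz0.le, ← div_eq_mul_inv, one_le_div (by positivity)]
            exact Real.rpow_le_rpow hz0.le (by have := h1.2; linarith) hp0.le
          rw [← mul_assoc]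
          exact le_mul_of_one_le_left (by positivity) h2
      _ = (2 * ‖x‖) ^ p * ∫ z in B, ‖z‖ ^ (-p) * |u z| ^ p := integral_const_mul _ _
      _ ≤ _ := by
        gcongr
        exact (setIntegral_mono_set (hu.integrable_weight hp1).integrableOn
          (ae_of_all _ fun z => by positivity) hBA.eventuallyLE).trans
          (hweight u D ‖x‖ hu hsupp hx hxD)
  have hGp : G ^ (1 / p) ≤ 2 * ‖x‖ * (C₁ ^ (1 / p) * (T * I) ^ (1 / p)) := by
    calc G ^ (1 / p) ≤ ((2 * ‖x‖) ^ p * (C₁ * T * I)) ^ (1 / p) :=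
          Real.rpow_le_rpow hG0 hG (by positivity)
      _ = _ := by
        rw [Real.mul_rpow (by positivity) (by positivity), ← Real.rpow_mul (by positivity),
          mul_one_div_cancel hp0.ne', Real.rpow_one, mul_assoc C₁,
          Real.mul_rpow hC₁.le (by positivity)]
  have h1 := setIntegral_abs_sub_le hp1 hp hu1 hu.continuous_gradient hxB
  have h2 := setIntegral_le_volume_rpow_mul (μ := volume) hBc (f := fun z => |u z|)
    hu1.continuous.abs.continuousOn (fun z _ => abs_nonneg _) hp1
  have hi1 : IntegrableOn (fun z => |u z - u x|) B :=
    (hu1.continuous.sub continuous_const).abs.continuousOn.integrableOn_compact hBc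
  have hi2 : IntegrableOn (fun z => |u z|) B :=
    hu1.continuous.abs.continuousOn.integrableOn_compact hBc
  have h3 : volume.real B * |u x| ≤ (∫ z in B, |u z|) + ∫ z in B, |u z - u x| := by
    rw [← smul_eq_mul, ← setIntegral_const, ← integral_add hi2 hi1]
    refine integral_mono (integrableOn_const hBc.measure_ne_top)
      (hi2.add hi1) fun z => ?_
    have := abs_sub_abs_le_abs_sub (u x) (u z)
    rw [abs_sub_comm] at this
    change |u x| ≤ |u z| + |u z - u x|
    linarith
  have h4 := le_of_volume_closedBall_mul_le
    (K := G ^ (1 / p) + 2 * r / (1 - n / p) * J ^ (1 / p)) hr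
    (h3.trans ((add_le_add h2 h1).trans_eq (by ring)))
  refine h4.trans ?_
  have hrs : ‖x‖ ^ (1 - n / p : ℝ) = ‖x‖ ^ (-(n / p : ℝ)) * ‖x‖ := by
    rw [← Real.rpow_add_one hx.ne']; congr 1; ring
  have hrn : r ^ (-(n / p : ℝ)) = (1 / 2) ^ (-(n / p : ℝ)) * ‖x‖ ^ (-(n / p : ℝ)) := by
    rw [← Real.mul_rpow (by norm_num) hx.le]; congr 1; rw [hr_def]; ring
  rw [hrs, hrn]
  calc v ^ (-(1 / p)) * ((1 / 2) ^ (-(n / p : ℝ)) * ‖x‖ ^ (-(n / p : ℝ))) *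
        (G ^ (1 / p) + 2 * r / (1 - n / p) * J ^ (1 / p))
      ≤ v ^ (-(1 / p)) * ((1 / 2) ^ (-(n / p : ℝ)) * ‖x‖ ^ (-(n / p : ℝ))) *
        (2 * ‖x‖ * (C₁ ^ (1 / p) * (T * I) ^ (1 / p)) +
          2 * r / (1 - n / p) * (C₂ ^ (1 / p) * (T * I) ^ (1 / p))) := by gcongr
    _ = _ := by rw [hr_def]; ring

/-- The function `r ↦ r ^ α * (1 + log (D / r))` is almost increasing; this is why `B = 1` suffices
in the theorem. -/
lemma rpow_mul_log_le {α d r D : ℝ} (hα : 0 < α) (hr : 0 < r) (hd : 0 < d) (hrd : r ≤ 2 * d)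
    (hdD : d ≤ D) :
    r ^ α * (1 + Real.log (D / r)) ≤ (2 ^ α + 1 / α) * (d ^ α * (1 + Real.log (D / d))) := by
  have hD : 0 < D := by linarith
  have hL : 0 ≤ Real.log (D / d) := Real.log_nonneg ((one_le_div hd).2 hdD)
  set q := r / d with hq_def
  have hq : 0 < q := div_pos hr hd
  have hq2 : q ≤ 2 := (div_le_iff₀ hd).2 hrd
  have e1 : Real.log (D / r) = Real.log (D / d) + Real.log q⁻¹ := by
    rw [← Real.log_mul (by positivity) (by positivity)]; congr 1; rw [hq_def]; field_simp
  have e2 : r ^ α = q ^ α * d ^ α := by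
    rw [← Real.mul_rpow hq.le hd.le]; congr 1; rw [hq_def]; field_simp
  have h1 : q ^ α * Real.log q⁻¹ ≤ 1 / α := by
    have h := Real.log_le_rpow_div (inv_nonneg.2 hq.le) hα
    rw [Real.inv_rpow hq.le] at h
    have hqα : 0 < q ^ α := Real.rpow_pos_of_pos hq _
    calc q ^ α * Real.log q⁻¹ ≤ q ^ α * ((q ^ α)⁻¹ / α) := by gcongr
      _ = 1 / α := by field_simp
  have h2 : q ^ α ≤ 2 ^ α := by gcongr
  have hdα : 0 < d ^ α := Real.rpow_pos_of_pos hd _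
  have h3 : 1 / α ≤ 1 / α * (1 + Real.log (D / d)) :=
    le_mul_of_one_le_right (by positivity) (by linarith)
  rw [e1, e2]
  calc q ^ α * d ^ α * (1 + (Real.log (D / d) + Real.log q⁻¹))
      = d ^ α * (q ^ α * (1 + Real.log (D / d)) + q ^ α * Real.log q⁻¹) := by ring
    _ ≤ d ^ α * (2 ^ α * (1 + Real.log (D / d)) + 1 / α * (1 + Real.log (D / d))) := by
      refine mul_le_mul_of_nonneg_left (add_le_add ?_ (h1.trans h3)) hdα.le
      gcongr
    _ = _ := by ring

theorem exists_abs_sub_le (n : ℕ) (hp1 : 1 < p) (hp : n < p) :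
    ∃ C : ℝ, 0 < C ∧ ∀ (u : EuclideanSpace ℝ (Fin n) → ℝ) (D : ℝ),
      IsTestFunction {0}ᶜ u → tsupport u ⊆ Metric.closedBall 0 D →
      ∀ (x y : EuclideanSpace ℝ (Fin n)), x ≠ y → ‖x‖ ≤ D → ‖y‖ ≤ D → ‖x - y‖ ≤ D →
      |u x - u y| ≤ C * (‖x - y‖ ^ (1 - n / p : ℝ) *
        ((1 + Real.log (D / ‖x - y‖)) * ∫ z, hardyRemainder p u z) ^ (1 / p)) := by
  obtain ⟨C₁, hC₁, hclose⟩ := exists_abs_sub_le_of_le_half_norm n hp1 hp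
  obtain ⟨C₂, hC₂, hpt⟩ := exists_abs_le_norm_rpow n hp1 hp
  have hp0 : 0 < p := by linarith
  have hα : 0 < p - n := by linarith
  set K := (2 : ℝ) ^ (p - n) + 1 / (p - n)
  have hK : 0 < K := by positivity
  refine ⟨C₁ + 2 * C₂ * K ^ (1 / p), by positivity, fun u D hu hsupp => ?_⟩
  have hI0 : 0 ≤ ∫ z, hardyRemainder p u z :=
    integral_nonneg fun z => hardyRemainder_nonneg hp1 z
  set I := ∫ z, hardyRemainder p u z
  suffices H : ∀ x y : EuclideanSpace ℝ (Fin n), x ≠ y → ‖x‖ ≤ D → ‖y‖ ≤ ‖x‖ → ‖x - y‖ ≤ D →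
      |u x - u y| ≤ (C₁ + 2 * C₂ * K ^ (1 / p)) * (‖x - y‖ ^ (1 - n / p : ℝ) *
        ((1 + Real.log (D / ‖x - y‖)) * I) ^ (1 / p)) by
    intro x y hxy hx hy hd
    rcases le_total ‖y‖ ‖x‖ with h | h
    · exact H x y hxy hx h hd
    · rw [abs_sub_comm, norm_sub_rev]
      exact H y x hxy.symm hy h (by rwa [norm_sub_rev])
  intro x y hxy hx hyx hdD
  set d := ‖x - y‖ with hd_def
  have hd : 0 < d := norm_pos_iff.2 (sub_ne_zero.2 hxy)
  have hL : 0 ≤ Real.log (D / d) := Real.log_nonneg ((one_le_div hd).2 hdD)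
  set Q := d ^ (1 - n / p : ℝ) * ((1 + Real.log (D / d)) * I) ^ (1 / p) with hQ
  have hQ0 : 0 ≤ Q := by positivity
  -- nearby points: local estimate; otherwise `|x|, |y| ≤ 2 d` and pointwise bounds suffice
  rcases le_or_gt d (‖x‖ / 2) with h | h
  · have hx0 : 0 < ‖x‖ := by linarith
    have h1 := hclose u D hu hsupp x y hxy hx h
    have h2 : Real.log (D / ‖x‖) ≤ Real.log (D / d) := by
      have : d ≤ ‖x‖ := by linarith
      have : 0 < D := by linarith
      apply Real.log_le_log (by positivity)
      gcongr
    have h3 : 0 ≤ Real.log (D / ‖x‖) := Real.log_nonneg ((one_le_div hx0).2 hx)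
    calc |u x - u y| ≤ _ := h1
      _ ≤ C₁ * d ^ (1 - n / p : ℝ) * ((1 + Real.log (D / d)) * I) ^ (1 / p) := by gcongr
      _ = C₁ * Q := by rw [hQ, mul_assoc]
      _ ≤ _ := by
        have : 0 ≤ 2 * C₂ * K ^ (1 / p) := by positivity
        gcongr; linarith
  · have hpt' : ∀ w, ‖w‖ ≤ ‖x‖ → |u w| ≤ C₂ * K ^ (1 / p) * Q := by
      intro w hw
      rcases eq_or_ne w 0 with rfl | hw0
      · have : u 0 = 0 := image_eq_zero_of_notMem_tsupport fun h =>
          hu.ne_zero_of_mem_tsupport h rfl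
        rw [this, abs_zero]; positivity
      have hw0' := norm_pos_iff.2 hw0
      refine (hpt u D hu hsupp w hw0 (hw.trans hx)).trans ?_
      have hLw : 0 ≤ Real.log (D / ‖w‖) :=
        Real.log_nonneg ((one_le_div hw0').2 (hw.trans hx))
      have hmono := rpow_mul_log_le (D := D) hα hw0' hd (by linarith : ‖w‖ ≤ 2 * d) hdD
      have conv : ∀ a L : ℝ, 0 < a → 0 ≤ L →
          a ^ (1 - n / p : ℝ) * (L * I) ^ (1 / p) = (a ^ (p - n) * L * I) ^ (1 / p) := by
        intro a L ha hL
        rw [mul_assoc, Real.mul_rpow (x := a ^ (p - n)) (by positivity) (by positivity),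
          ← Real.rpow_mul ha.le]
        congr 2; field_simp
      rw [hQ, conv _ _ hw0' (by linarith), conv _ _ hd (by linarith), mul_assoc C₂,
        ← Real.mul_rpow hK.le (by positivity)]
      refine mul_le_mul_of_nonneg_left (Real.rpow_le_rpow (by positivity) ?_ (by positivity)) hC₂.le
      rw [← mul_assoc]
      exact mul_le_mul_of_nonneg_right hmono hI0
    calc |u x - u y| ≤ |u x| + |u y| := abs_sub _ _
      _ ≤ C₂ * K ^ (1 / p) * Q + C₂ * K ^ (1 / p) * Q := add_le_add (hpt' x le_rfl) (hpt' y hyx)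
      _ ≤ _ := by nlinarith [mul_nonneg hC₁.le hQ0]

lemma logX_div {d D : ℝ} : logX (d / D) = (1 + Real.log (D / d))⁻¹ := by
  rw [logX, ← inv_div d D, Real.log_inv, sub_eq_add_neg]

namespace IsBoundedDomainWithOrigin
variable {Ω : Set (EuclideanSpace ℝ (Fin n))}

lemma norm_le_diam (hΩ : IsBoundedDomainWithOrigin Ω) {x : EuclideanSpace ℝ (Fin n)}
    (hx : x ∈ Ω) : ‖x‖ ≤ Metric.diam Ω := by
  rw [← dist_zero_right]
  exact Metric.dist_le_diam_of_mem hΩ.isBounded hx hΩ.zero_mem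

end IsBoundedDomainWithOrigin

theorem exists_weightedHolderSeminorm_le (n : ℕ) (hp1 : 1 < p) (hp : n < p) :
    ∃ C : ℝ, 0 < C ∧ ∀ Ω : Set (EuclideanSpace ℝ (Fin n)), IsBoundedDomainWithOrigin Ω →
      ∀ u : EuclideanSpace ℝ (Fin n) → ℝ, IsTestFunction (Ω \ {0}) u →
        weightedHolderSeminorm p (1 / p) (Metric.diam Ω) Ω u ≤
          ((C * hardyDifference p Ω u ^ (1 / p) : ℝ) : EReal) := by
  obtain ⟨C, hC, h⟩ := exists_abs_sub_le n hp1 hp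
  refine ⟨C, hC, fun Ω hΩ u hu => ?_⟩
  have hu0 : IsTestFunction {0}ᶜ u := hu.mono fun x hx => hx.2
  refine iSup₂_le fun x hx => iSup₂_le fun y hy => iSup_le fun hxy => ?_
  rw [EReal.coe_le_coe_iff, IsTestFunction.hardyDifference_eq hu hp1 hp, logX_div]
  have hI0 : 0 ≤ ∫ z, hardyRemainder p u z :=
    integral_nonneg fun z => hardyRemainder_nonneg hp1 z
  have hd : 0 < ‖x - y‖ := norm_pos_iff.2 (sub_ne_zero.2 hxy)
  have hdD : ‖x - y‖ ≤ Metric.diam Ω := by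
    rw [← dist_eq_norm]; exact Metric.dist_le_diam_of_mem hΩ.isBounded hx hy
  have hL : 0 ≤ Real.log (Metric.diam Ω / ‖x - y‖) := Real.log_nonneg ((one_le_div hd).2 hdD)
  have h1 := h u (Metric.diam Ω) hu0
    (fun z hz => by simpa using hΩ.norm_le_diam (hu.tsupport_subset hz).1)
    x y hxy (hΩ.norm_le_diam hx) (hΩ.norm_le_diam hy) hdD
  set L := 1 + Real.log (Metric.diam Ω / ‖x - y‖)
  have hL1 : 0 < L := by simp only [L]; linarith
  rw [Real.mul_rpow hL1.le hI0] at h1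
  have hLp : 0 < L ^ (1 / p) := Real.rpow_pos_of_pos hL1 _
  rw [Real.inv_rpow hL1.le, ← div_eq_mul_inv, div_le_iff₀ hLp,
    div_le_iff₀ (Real.rpow_pos_of_pos hd _)]
  linarith

end

/-! ### Optimality of the exponent -/

section

lemma powRemainder_smul_self {E : Type*} [NormedAddCommGroup E] [InnerProductSpace ℝ E] {p : ℝ}
    (hp : 0 < p) (a : E) (m : ℝ) :
    powRemainder p a (m • a) = ‖a‖ ^ p * (|1 + m| ^ p - 1 - p * m) := by
  rcases eq_or_ne a 0 with rfl | ha
  · simp [powRemainder, Real.zero_rpow hp.ne']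
  have ha0 := norm_pos_iff.2 ha
  have e1 : a + m • a = (1 + m) • a := by module
  have e2 : ‖a‖ ^ p = ‖a‖ ^ (p - 2) * ‖a‖ ^ 2 := by
    rw [← Real.rpow_natCast ‖a‖ 2, ← Real.rpow_add ha0]; congr 1; push_cast; ring
  rw [powRemainder, e1, norm_smul, Real.mul_rpow (norm_nonneg _) (norm_nonneg _),
    Real.norm_eq_abs, real_inner_smul_right, real_inner_self_eq_norm_sq, e2]
  ring

/-- A smooth bump on the line, equal to one near `3 / 2` and supported in `[1, 2]`. -/
noncomputable def logBump : ContDiffBump (3 / 2 : ℝ) := ⟨1 / 4, 1 / 2, by norm_num, by norm_num⟩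

/-- The function `q ^ (s / 2) * ψ(-log q / (2 * T)) ^ 2`, with `ψ` the bump `logBump`, to be evaluated
at `q = |x| ^ 2`, which is smooth in `x`. The square makes `ψ ^ (2 * p) * |ψ' / ψ| ^ k` bounded for all
`k ≤ 2 * p`. -/
noncomputable def logProfile (s T q : ℝ) : ℝ := q ^ (s / 2) * logBump (-Real.log q / (2 * T)) ^ 2

/-- The function `|x| ^ ((p - n) / p) * ψ(-log |x| / T) ^ 2`: the virtual ground state, cut off slowly
on the logarithmic scale. -/
noncomputable def logTest (n : ℕ) (p T : ℝ) (x : EuclideanSpace ℝ (Fin n)) : ℝ :=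
  logProfile ((p - n) / p) T (‖x‖ ^ 2)

/-- The shell `exp (-2 T) ≤ |x| ≤ exp (-T)`, which contains the support of `logTest n p T`. -/
def logShell (n : ℕ) (T : ℝ) : Set (EuclideanSpace ℝ (Fin n)) :=
  {x | Real.exp (-(2 * T)) ≤ ‖x‖ ∧ ‖x‖ ≤ Real.exp (-T)}

lemma logBump_eq_zero {t : ℝ} (ht : t ≤ 1 ∨ 2 ≤ t) : logBump t = 0 := by
  apply ContDiffBump.zero_of_le_dist
  rw [Real.dist_eq]
  change 1 / 2 ≤ |t - 3 / 2|
  rcases ht with h | h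
  · rw [abs_of_nonpos (by linarith)]; linarith
  · rw [abs_of_nonneg (by linarith)]; linarith

lemma logBump_center : logBump (3 / 2) = 1 := by
  apply ContDiffBump.one_of_mem_closedBall
  exact Metric.mem_closedBall_self (by norm_num [logBump])

lemma exists_deriv_logBump_le : ∃ M : ℝ, 0 < M ∧ ∀ t, |deriv logBump t| ≤ M := by
  have h1 : Continuous (deriv logBump) := (logBump.contDiff (n := 1)).continuous_deriv le_rfl
  obtain ⟨M, hM⟩ := h1.bounded_above_of_compact_support logBump.hasCompactSupport.deriv
  exact ⟨max M 1, by positivity, fun t => (hM t).trans (le_max_left _ _)⟩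

lemma contDiffAt_logProfile (s T : ℝ) {q : ℝ} (hq : q ≠ 0) :
    ContDiffAt ℝ ∞ (logProfile s T) q := by
  refine ContDiffAt.mul (Real.contDiffAt_rpow_const_of_ne hq) (ContDiffAt.pow ?_ 2)
  exact logBump.contDiff.contDiffAt.comp q ((Real.contDiffAt_log.2 hq).neg.div_const _)

lemma deriv_logProfile (s T : ℝ) {q : ℝ} (hq : 0 < q) :
    deriv (logProfile s T) q = q ^ (s / 2 - 1) *
      (s / 2 * logBump (-Real.log q / (2 * T)) ^ 2 -
        logBump (-Real.log q / (2 * T)) * deriv logBump (-Real.log q / (2 * T)) / T) := by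
  set t := -Real.log q / (2 * T) with ht
  have h1 : HasDerivAt (fun q : ℝ => q ^ (s / 2)) (s / 2 * q ^ (s / 2 - 1)) q :=
    Real.hasDerivAt_rpow_const (Or.inl hq.ne')
  have h2 : HasDerivAt (fun q : ℝ => -Real.log q / (2 * T)) (-q⁻¹ / (2 * T)) q :=
    (Real.hasDerivAt_log hq.ne').neg.div_const _
  have h3 : HasDerivAt logBump (deriv logBump t) t :=
    ((logBump.contDiff (n := 1)).differentiable one_ne_zero t).hasDerivAt
  have h4 := (h3.comp q h2).pow 2
  have h5 : deriv (logProfile s T) q = _ := (h1.mul h4).deriv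
  rw [h5]
  simp only [Function.comp_apply, Pi.pow_apply, ← ht]
  rw [show q ^ (s / 2) = q ^ (s / 2 - 1) * q by
    rw [← Real.rpow_add_one hq.ne', sub_add_cancel]]
  field_simp
  ring

variable {n : ℕ} {p T : ℝ}

lemma log_norm_sq_div (hT : 0 < T) (x : EuclideanSpace ℝ (Fin n)) :
    -Real.log (‖x‖ ^ 2) / (2 * T) = -Real.log ‖x‖ / T := by
  rw [Real.log_pow]; push_cast; field_simp

lemma logBump_eq_zero_of_notMem (hT : 0 < T) {x : EuclideanSpace ℝ (Fin n)}
    (hx : x ∉ logShell n T) : logBump (-Real.log (‖x‖ ^ 2) / (2 * T)) = 0 := by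
  rw [log_norm_sq_div hT]
  apply logBump_eq_zero
  rcases eq_or_ne x 0 with rfl | hx0
  · left; simp
  have hr := norm_pos_iff.2 hx0
  by_contra! h
  rw [lt_div_iff₀ hT, div_lt_iff₀ hT] at h
  refine hx ⟨?_, ?_⟩
  · rw [← Real.le_log_iff_exp_le hr]; linarith
  · rw [← Real.log_le_iff_le_exp hr]; linarith

lemma logTest_eq_zero (hT : 0 < T) {x : EuclideanSpace ℝ (Fin n)}
    (hx : x ∉ logShell n T) : logTest n p T x = 0 := by
  rw [logTest, logProfile, logBump_eq_zero_of_notMem hT hx]; simp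

lemma ne_zero_of_mem_logShell {x : EuclideanSpace ℝ (Fin n)} (hx : x ∈ logShell n T) : x ≠ 0 :=
  norm_pos_iff.1 ((Real.exp_pos _).trans_le hx.1)

lemma isCompact_logShell : IsCompact (logShell n T) := by
  refine (isCompact_closedBall (0 : EuclideanSpace ℝ (Fin n)) (Real.exp (-T))).of_isClosed_subset
    ((isClosed_le continuous_const continuous_norm).inter
      (isClosed_le continuous_norm continuous_const)) fun x hx => ?_
  simpa using hx.2

lemma isTestFunction_logTest (hT : 0 < T) {Ω : Set (EuclideanSpace ℝ (Fin n))}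
    (hΩ : logShell n T ⊆ Ω) : IsTestFunction (Ω \ {0}) (logTest n p T) := by
  have hts : tsupport (logTest n p T) ⊆ logShell n T :=
    closure_minimal (fun x hx => by
      by_contra h
      exact hx (logTest_eq_zero hT h)) isCompact_logShell.isClosed
  refine ⟨contDiff_iff_contDiffAt.2 fun x => ?_,
    isCompact_logShell.of_isClosed_subset (isClosed_tsupport _) hts,
    fun x hx => ⟨hΩ (hts hx), ne_zero_of_mem_logShell (hts hx)⟩⟩
  by_cases hx : x ∈ logShell n T
  · have hx0 : ‖x‖ ^ 2 ≠ 0 := by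
      have := norm_ne_zero_iff.2 (ne_zero_of_mem_logShell hx)
      positivity
    exact (contDiffAt_logProfile _ T hx0).comp x (contDiff_norm_sq ℝ).contDiffAt
  · refine (contDiffAt_const (c := (0 : ℝ))).congr_of_eventuallyEq ?_
    filter_upwards [isCompact_logShell.isClosed.isOpen_compl.mem_nhds hx] with y hy
      using logTest_eq_zero hT hy

lemma gradient_logTest {x : EuclideanSpace ℝ (Fin n)} (hx : x ≠ 0) :
    ∇ (logTest n p T) x = ((‖x‖ ^ 2) ^ ((p - n) / p / 2 - 1) *
      ((p - n) / p * logBump (-Real.log (‖x‖ ^ 2) / (2 * T)) ^ 2 -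
        2 * logBump (-Real.log (‖x‖ ^ 2) / (2 * T)) *
          deriv logBump (-Real.log (‖x‖ ^ 2) / (2 * T)) / T)) • x := by
  have hq : 0 < ‖x‖ ^ 2 := by have := norm_pos_iff.2 hx; positivity
  have h1 := ((contDiffAt_logProfile ((p - n) / p) T hq.ne').differentiableAt (by simp)).hasDerivAt
  have h2 := h1.comp_hasFDerivAt x (hasStrictFDerivAt_norm_sq x).hasFDerivAt
  rw [deriv_logProfile _ _ hq] at h2
  refine HasGradientAt.gradient ?_
  rw [hasGradientAt_iff_hasFDerivAt]
  refine h2.congr_fderiv ?_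
  ext y
  simp
  ring

lemma norm_sq_rpow_half (x : EuclideanSpace ℝ (Fin n)) (α : ℝ) :
    (‖x‖ ^ 2) ^ (α / 2) = ‖x‖ ^ α := by
  rw [← Real.rpow_natCast, ← Real.rpow_mul (norm_nonneg _)]; congr 1; push_cast; ring

/-- Where the bump `ψ` does not vanish, `∇ u - a = μ a` for `a = hardyField p u` and a scalar `μ` of
order `1 / (T * ψ)`, so that the remainder is of second order in `1 / T`. -/
theorem exists_hardyRemainder_logTest_le (n : ℕ) (hp1 : 1 < p) (hp : n < p) :
    ∃ C : ℝ, 0 < C ∧ ∀ (T : ℝ), 1 ≤ T → ∀ x : EuclideanSpace ℝ (Fin n),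
      hardyRemainder p (logTest n p T) x ≤
        C * (T ^ 2)⁻¹ * (logShell n T).indicator (fun x => ‖x‖ ^ (-n : ℝ)) x := by
  obtain ⟨M, hM, hMd⟩ := exists_deriv_logBump_le
  have hp0 : 0 < p := by linarith
  set s := (p - n) / p with hs_def
  have hs : 0 < s := div_pos (by linarith) hp0
  set N := max p 2 with hN
  set K := 2 * p ^ 2 + (2 * p + 1) ^ N with hK_def
  have hK : 0 < K := by positivity
  set m := 2 * M / s with hm_def
  have hm : 0 < m := by positivity
  refine ⟨s ^ p * (K * (m ^ 2 + m ^ N)), by positivity, fun T hT x => ?_⟩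
  have hT0 : 0 < T := by linarith
  set t := -Real.log (‖x‖ ^ 2) / (2 * T) with ht
  have hR : 0 ≤ s ^ p * (K * (m ^ 2 + m ^ N)) * (T ^ 2)⁻¹ *
      (logShell n T).indicator (fun x => ‖x‖ ^ (-n : ℝ)) x := by
    have : 0 ≤ (logShell n T).indicator (fun x => ‖x‖ ^ (-n : ℝ)) x :=
      Set.indicator_nonneg (fun y _ => by positivity) _
    positivity
  by_cases hψ0 : logBump t = 0
  · have hu : logTest n p T x = 0 := by
      rw [logTest, logProfile, ← ht, hψ0]; simp
    have ha : hardyField p (logTest n p T) x = 0 := by simp [hardyField, hu]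
    have : hardyRemainder p (logTest n p T) x = 0 := by
      rcases eq_or_ne x 0 with rfl | hx
      · have h1 : IsTestFunction (Set.univ \ {0}) (logTest n p T) :=
          isTestFunction_logTest hT0 (Set.subset_univ _)
        exact hardyRemainder_eq_zero hp1 fun h => (h1.tsupport_subset h).2 rfl
      · have hg : ∇ (logTest n p T) x = 0 := by
          rw [gradient_logTest hx, ← ht, hψ0]; simp
        rw [hardyRemainder, ha, hg, powRemainder]
        simp [Real.zero_rpow hp0.ne']
    rw [this]; exact hR
  have hxS : x ∈ logShell n T := by
    by_contra h; exact hψ0 (logBump_eq_zero_of_notMem hT0 h)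
  have hx := ne_zero_of_mem_logShell hxS
  have hr := norm_pos_iff.2 hx
  set ψ := logBump t
  have hψ : 0 < ψ := lt_of_le_of_ne logBump.nonneg (Ne.symm hψ0)
  have hψ1 : ψ ≤ 1 := logBump.le_one
  set μ := -(2 * deriv logBump t / (s * T * ψ)) with hμ
  have hu : logTest n p T x = ‖x‖ ^ s * ψ ^ 2 := by
    rw [logTest, logProfile, norm_sq_rpow_half]
  have hb : ∇ (logTest n p T) x - hardyField p (logTest n p T) x =
      μ • hardyField p (logTest n p T) x := by
    rw [gradient_logTest hx, hardyField, hu, ← ht, ← hs_def, smul_smul, ← sub_smul]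
    congr 1
    rw [Real.rpow_sub_one (by positivity), norm_sq_rpow_half]
    change ‖x‖ ^ s / ‖x‖ ^ 2 * (s * ψ ^ 2 - 2 * ψ * deriv logBump t / T) -
      s * (‖x‖ ^ s * ψ ^ 2) / ‖x‖ ^ 2 = μ * (s * (‖x‖ ^ s * ψ ^ 2) / ‖x‖ ^ 2)
    rw [hμ]
    field_simp
    ring
  have hnorm : ‖hardyField p (logTest n p T) x‖ ^ p = s ^ p * (‖x‖ ^ (-n : ℝ) * ψ ^ (2 * p)) := by
    rw [norm_hardyField_rpow hp hx, hu, abs_of_pos (by positivity),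
      Real.mul_rpow (by positivity) (by positivity), ← Real.rpow_mul hr.le,
      ← Real.rpow_natCast ψ 2, ← Real.rpow_mul hψ.le]
    have : ‖x‖ ^ (-n : ℝ) = ‖x‖ ^ (s * p) * ‖x‖ ^ (-p) := by
      rw [← Real.rpow_add hr]; congr 1; rw [hs_def]; field_simp; ring
    rw [this]; push_cast; ring
  have hμabs : |μ| ≤ m / (T * ψ) := by
    rw [hμ, abs_neg, abs_div, abs_mul, abs_of_pos (show 0 < s * T * ψ by positivity),
      abs_of_pos (two_pos : (0 : ℝ) < 2), hm_def, div_div, mul_assoc s]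
    have := hMd t
    gcongr
  have hpow : ∀ k : ℝ, 2 ≤ k → k ≤ 2 * p → ψ ^ (2 * p) * |μ| ^ k ≤ m ^ k * (T ^ 2)⁻¹ := by
    intro k hk2 hkp
    calc ψ ^ (2 * p) * |μ| ^ k ≤ ψ ^ (2 * p) * (m / (T * ψ)) ^ k := by gcongr
      _ = ψ ^ (2 * p - k) * (m ^ k * (T ^ k)⁻¹) := by
        rw [Real.div_rpow hm.le (by positivity), Real.mul_rpow hT0.le hψ.le, Real.rpow_sub hψ]
        field_simp
      _ ≤ 1 * (m ^ k * (T ^ 2)⁻¹) := by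
        have h1 : ψ ^ (2 * p - k) ≤ 1 := Real.rpow_le_one hψ.le hψ1 (by linarith)
        have h2 : T ^ 2 ≤ T ^ k := by
          rw [← Real.rpow_natCast]; exact Real.rpow_le_rpow_of_exponent_le hT (by simpa using hk2)
        gcongr
      _ = _ := one_mul _
  have hsc := abs_one_add_rpow_le hp1 μ
  rw [← hN, ← hK_def] at hsc
  have h2 := hpow 2 le_rfl (by linarith)
  have h3 := hpow N (le_max_right _ _) (max_le (by linarith) (by linarith))
  rw [Real.rpow_two, Real.rpow_two, sq_abs] at h2
  rw [hardyRemainder, hb, powRemainder_smul_self hp0, hnorm, Set.indicator_of_mem hxS]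
  calc s ^ p * (‖x‖ ^ (-n : ℝ) * ψ ^ (2 * p)) * (|1 + μ| ^ p - 1 - p * μ)
      ≤ s ^ p * (‖x‖ ^ (-n : ℝ) * ψ ^ (2 * p)) * (K * (μ ^ 2 + |μ| ^ N)) := by
        gcongr; linarith
    _ = s ^ p * ‖x‖ ^ (-n : ℝ) * K * (ψ ^ (2 * p) * μ ^ 2 + ψ ^ (2 * p) * |μ| ^ N) := by ring
    _ ≤ s ^ p * ‖x‖ ^ (-n : ℝ) * K * (m ^ 2 * (T ^ 2)⁻¹ + m ^ N * (T ^ 2)⁻¹) := by gcongr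
    _ = _ := by ring

lemma integral_logShell (hn : 1 ≤ n) (hT : 0 < T) :
    ∫ x, (logShell n T).indicator (fun x => ‖x‖ ^ (-n : ℝ)) x =
      n * volume.real (Metric.ball (0 : EuclideanSpace ℝ (Fin n)) 1) * T := by
  have hnt : Nonempty (Fin n) := ⟨⟨0, hn⟩⟩
  set S := Set.Icc (Real.exp (-(2 * T))) (Real.exp (-T)) with hS
  have hle : Real.exp (-(2 * T)) ≤ Real.exp (-T) := Real.exp_le_exp.2 (by linarith)
  have hpos : S ⊆ Set.Ioi 0 := fun r hr => (Real.exp_pos _).trans_le hr.1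
  have h1 : ∀ x : EuclideanSpace ℝ (Fin n),
      (logShell n T).indicator (fun x => ‖x‖ ^ (-n : ℝ)) x
        = S.indicator (fun r : ℝ => r ^ (-n : ℝ)) ‖x‖ := fun x => rfl
  simp_rw [h1]
  rw [integral_fun_norm_addHaar volume (fun r => S.indicator (fun r : ℝ => r ^ (-n : ℝ)) r),
    finrank_euclideanSpace_fin]
  have h2 : ∀ r ∈ Set.Ioi (0 : ℝ), r ^ (n - 1) • S.indicator (fun r : ℝ => r ^ (-n : ℝ)) r
      = S.indicator (fun r : ℝ => r⁻¹) r := by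
    intro r hr
    have hr : 0 < r := hr
    by_cases hrS : r ∈ S
    · rw [Set.indicator_of_mem hrS, Set.indicator_of_mem hrS, smul_eq_mul, Real.rpow_neg hr.le,
        Real.rpow_natCast, ← div_eq_mul_inv, ← Nat.sub_add_cancel hn, pow_succ]
      simp only [Nat.add_sub_cancel]
      field_simp
    · rw [Set.indicator_of_notMem hrS, Set.indicator_of_notMem hrS, smul_zero]
  rw [setIntegral_congr_fun measurableSet_Ioi h2, setIntegral_indicator measurableSet_Icc,
    Set.inter_eq_right.2 hpos,
    integral_Icc_eq_integral_Ioc, ← intervalIntegral.integral_of_le hle,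
    integral_inv_of_pos (Real.exp_pos _) (Real.exp_pos _), ← Real.exp_sub, Real.log_exp]
  simp only [nsmul_eq_mul, smul_eq_mul]
  ring

lemma integrable_logShell :
    Integrable ((logShell n T).indicator (fun x => ‖x‖ ^ (-n : ℝ))) := by
  refine (integrable_indicator_iff isCompact_logShell.measurableSet).2
    (ContinuousOn.integrableOn_compact isCompact_logShell fun x hx => ?_)
  exact (continuous_norm.continuousAt.rpow_const
    (Or.inl (norm_pos_iff.2 (ne_zero_of_mem_logShell hx)).ne')).continuousWithinAt

theorem exists_integral_hardyRemainder_logTest_le (hn : 1 ≤ n) (hp1 : 1 < p) (hp : n < p) :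
    ∃ C : ℝ, 0 < C ∧ ∀ T : ℝ, 1 ≤ T → ∫ x, hardyRemainder p (logTest n p T) x ≤ C / T := by
  obtain ⟨C, hC, h⟩ := exists_hardyRemainder_logTest_le n hp1 hp
  have hv : 0 < volume.real (Metric.ball (0 : EuclideanSpace ℝ (Fin n)) 1) :=
    volume_real_unit_ball_pos n
  have hn0 : (0 : ℝ) < n := by exact_mod_cast hn
  refine ⟨C * (n * volume.real (Metric.ball (0 : EuclideanSpace ℝ (Fin n)) 1)), by positivity,
    fun T hT => ?_⟩
  have hT0 : 0 < T := by linarith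
  have htest : IsTestFunction {0}ᶜ (logTest n p T) :=
    (isTestFunction_logTest hT0 (Set.subset_univ _)).mono fun x hx => hx.2
  refine (integral_mono (htest.integrable_hardyRemainder hp1 hp)
    (integrable_logShell.const_mul _) (h T hT)).trans_eq ?_
  rw [integral_const_mul, integral_logShell hn hT0]
  field_simp

/-- On `logTest n p T` the Hardy difference is `O(1 / T)`, while the quotient at the points `0` and
`x` with `|x| = exp (-3 T / 2)` is of order `T ^ (-q)`. -/
theorem not_forall_weightedHolderSeminorm_le (hn : 1 ≤ n) (hp1 : 1 < p) (hp : n < p) {q : ℝ}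
    (hq : q < 1 / p) {Ω : Set (EuclideanSpace ℝ (Fin n))} (hΩ : IsBoundedDomainWithOrigin Ω)
    {B C : ℝ} (hB : 1 ≤ B) (hC : 0 < C) :
    ¬ ∀ u : EuclideanSpace ℝ (Fin n) → ℝ, IsTestFunction (Ω \ {0}) u →
      weightedHolderSeminorm p q (B * Metric.diam Ω) Ω u ≤
        ((C * hardyDifference p Ω u ^ (1 / p) : ℝ) : EReal) := by
  intro hall
  have hp0 : 0 < p := by linarith
  obtain ⟨C₁, hC₁, hI⟩ := exists_integral_hardyRemainder_logTest_le hn hp1 hp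
  obtain ⟨δ, hδ, hball⟩ := Metric.isOpen_iff.1 hΩ.isOpen 0 hΩ.zero_mem
  set D := B * Metric.diam Ω with hD_def
  set K := C * C₁ ^ (1 / p) * 2 ^ (1 / p) with hK
  have hev1 : ∀ᶠ T : ℝ in Filter.atTop, K < T ^ (1 / p - q) :=
    (tendsto_rpow_atTop (by linarith)).eventually_gt_atTop K
  have hev2 : ∀ᶠ T : ℝ in Filter.atTop, Real.exp (-T) < δ :=
    (Real.tendsto_exp_atBot.comp Filter.tendsto_neg_atTop_atBot).eventually_lt_const hδ
  obtain ⟨T, ⟨⟨⟨hT1, hT2⟩, hT3⟩, hT4⟩⟩ := (((hev1.and hev2).and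
    (Filter.eventually_ge_atTop (1 : ℝ))).and
    (Filter.eventually_ge_atTop (2 * |1 + Real.log D|))).exists
  have hT0 : 0 < T := by linarith
  have hmem : ∀ x : EuclideanSpace ℝ (Fin n), ‖x‖ ≤ Real.exp (-T) → x ∈ Ω := fun x hx =>
    hball (by rw [mem_ball_zero_iff]; linarith)
  have htest : IsTestFunction (Ω \ {0}) (logTest n p T) :=
    isTestFunction_logTest hT0 fun x hx => hmem x hx.2
  set r := Real.exp (-(3 / 2 * T)) with hr_def
  have hr : 0 < r := Real.exp_pos _
  set x : EuclideanSpace ℝ (Fin n) := EuclideanSpace.single ⟨0, hn⟩ r with hx_def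
  have hxr : ‖x‖ = r := by rw [hx_def, PiLp.norm_single, Real.norm_of_nonneg hr.le]
  have hx0 : x ≠ 0 := norm_pos_iff.1 (hxr ▸ hr)
  have hxΩ : x ∈ Ω := hmem x (by rw [hxr]; exact Real.exp_le_exp.2 (by linarith))
  have hD : 0 < D := by
    have h1 := hΩ.norm_le_diam hxΩ
    rw [hxr] at h1
    have : 0 < Metric.diam Ω := by linarith
    positivity
  have hux : logTest n p T x = r ^ (1 - n / p : ℝ) := by
    rw [logTest, logProfile, log_norm_sq_div hT0, norm_sq_rpow_half, hxr, hr_def, Real.log_exp,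
      show -(-(3 / 2 * T)) / T = 3 / 2 by field_simp, logBump_center]
    rw [show (p - n) / p = 1 - (n : ℝ) / p by field_simp]; ring
  have hu0 : logTest n p T 0 = 0 := logTest_eq_zero hT0 fun h => ne_zero_of_mem_logShell h rfl
  set L := 1 + Real.log D + 3 / 2 * T with hL
  have hlogX : logX (‖x - 0‖ / D) = L⁻¹ := by
    rw [logX_div, sub_zero, hxr, Real.log_div hD.ne' hr.ne', hr_def, Real.log_exp, hL]
    congr 1; ring
  have habs := abs_le.1 (show |1 + Real.log D| ≤ T / 2 by linarith)
  have hLT : T ≤ L := by rw [hL]; linarith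
  have hLT2 : L ≤ 2 * T := by rw [hL]; linarith
  have hL0 : 0 < L := by linarith
  have hle : (((L⁻¹) ^ q : ℝ) : EReal) ≤ weightedHolderSeminorm p q D Ω (logTest n p T) := by
    refine le_iSup₂_of_le x hxΩ (le_iSup₂_of_le 0 hΩ.zero_mem (le_iSup_of_le hx0 ?_))
    rw [hlogX, hux, hu0, sub_zero, sub_zero, hxr, abs_of_pos (by positivity),
      div_self (by positivity), one_mul]
  have hfin := hle.trans (hall _ htest)
  rw [EReal.coe_le_coe_iff, IsTestFunction.hardyDifference_eq htest hp1 hp] at hfin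
  have hI0 : 0 ≤ ∫ x, hardyRemainder p (logTest n p T) x :=
    integral_nonneg fun z => hardyRemainder_nonneg hp1 z
  have hfin2 : (L ^ q)⁻¹ ≤ C * (C₁ ^ (1 / p) / T ^ (1 / p)) := by
    rw [← Real.inv_rpow hL0.le, ← Real.div_rpow hC₁.le hT0.le]
    refine hfin.trans ?_
    gcongr
    exact hI T hT3
  refine absurd hT1 (not_lt.2 ?_)
  calc T ^ (1 / p - q) ≤ L ^ (1 / p - q) := by
        have : 0 ≤ 1 / p - q := by linarith
        gcongr
    _ = L ^ (1 / p) * (L ^ q)⁻¹ := by rw [Real.rpow_sub hL0, div_eq_mul_inv]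
    _ ≤ (2 * T) ^ (1 / p) * (C * (C₁ ^ (1 / p) / T ^ (1 / p))) := by gcongr
    _ = K := by
      rw [Real.mul_rpow two_pos.le hT0.le, hK]
      have : T ^ (1 / p) ≠ 0 := by positivity
      field_simp

end

theorem theoremB (n : ℕ) (hn : 1 ≤ n) (p : ℝ) (hp : (n : ℝ) < p) :
    (∃ B C : ℝ, 1 ≤ B ∧ 0 < C ∧
      ∀ Ω : Set (EuclideanSpace ℝ (Fin n)), IsBoundedDomainWithOrigin Ω →
        ∀ u : EuclideanSpace ℝ (Fin n) → ℝ, IsTestFunction (Ω \ {0}) u →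
          weightedHolderSeminorm p (1 / p) (B * Metric.diam Ω) Ω u ≤
            ((C * hardyDifference p Ω u ^ (1 / p) : ℝ) : EReal)) ∧
    (∀ q : ℝ, q < 1 / p →
      ∀ Ω : Set (EuclideanSpace ℝ (Fin n)), IsBoundedDomainWithOrigin Ω →
        ∀ B C : ℝ, 1 ≤ B → 0 < C →
          ¬ ∀ u : EuclideanSpace ℝ (Fin n) → ℝ, IsTestFunction (Ω \ {0}) u →
            weightedHolderSeminorm p q (B * Metric.diam Ω) Ω u ≤
              ((C * hardyDifference p Ω u ^ (1 / p) : ℝ) : EReal)) := by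
  have hp1 : 1 < p := (by exact_mod_cast hn : (1 : ℝ) ≤ n).trans_lt hp
  refine ⟨?_, fun q hq Ω hΩ B C hB hC =>
    not_forall_weightedHolderSeminorm_le hn hp1 hp hq hΩ hB hC⟩
  obtain ⟨C, hC, h⟩ := exists_weightedHolderSeminorm_le n hp1 hp
  exact ⟨1, C, le_rfl, hC, fun Ω hΩ u hu => by rw [one_mul]; exact h Ω hΩ u hu⟩
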